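/- Let $S^1=\mathbb R/\mathbb Z$. For $r\in\mathbb N$ let $\mathrm{Diff}^r(S^1)$ be the group of orientation preserving $C^r$-diffeomorphisms of $S^1$ (orientation preserving homeomorphisms if $r=0$), and give $\mathrm{Diff}^1(S^1)$ the $C^1$-topology (uniform convergence of the maps and of their derivatives). For $\alpha\in(\mathbb R\setminus\mathbb Q)/\mathbb Z$ let $F^1_\alpha\subset \mathrm{Diff}^1(S^1)$ be the set of $C^1$-diffeomorphisms with rotation number $\alpha$, and for $f\in \mathrm{Diff}^1(S^1)$ and $r\in\mathbb N$ let $\mathcal C^r(f)=\{hfh^{-1} : h\in \mathrm{Diff}^r(S^1)\}\cap \mathrm{Diff}^1(S^1)$ be its $C^r$-conjugacy class (the intersection matters only for $r=0$). Theorem. Let $\alpha\in(\mathbb R\setminus\mathbb Q)/\mathbb Z$ and $f\in F^1_\alpha$. Then the $C^1$-conjugacy class $\mathcal C^1(f)$ is contained in $F^1_\alpha$ and is dense in $F^1_\alpha$ for the $C^1$-topology. Moreover, for every $r\in\mathbb N$, the $C^r$-conjugacy class $\mathcal C^r(f)$ is contained in $F^1_\alpha$ and is dense in $F^1_\alpha$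 for the $C^1$-topology. -/

import Mathlib

open scoped Topology UniformConvergence

namespace CircleDiffeo

/-- `F : ℝ → ℝ`, a nondecreasing map with `F (x + 1) = F x + 1`, is a lift of the circle
homeomorphism `f : ℝ/ℤ → ℝ/ℤ`. A homeomorphism has such a lift exactly when it preserves the
orientation. -/
def IsLift (F : CircleDeg1Lift) (f : UnitAddCircle ≃ₜ UnitAddCircle) : Prop :=
  ∀ x : ℝ, ((F x : ℝ) : UnitAddCircle) = f (x : UnitAddCircle)

/-- `f` has a lift to the real line of class `C^r`. -/
def HasCrLift (r : ℕ) (f : UnitAddCircle ≃ₜ UnitAddCircle) : Prop :=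
  ∃ F : CircleDeg1Lift, IsLift F f ∧ ContDiff ℝ r F

theorem HasCrLift.one (r : ℕ) : HasCrLift r 1 :=
  ⟨1, fun _ => rfl, by simpa using contDiff_id⟩

theorem HasCrLift.mul {r : ℕ} {f g : UnitAddCircle ≃ₜ UnitAddCircle}
    (hf : HasCrLift r f) (hg : HasCrLift r g) : HasCrLift r (f * g) := by
  obtain ⟨F, hF, hF'⟩ := hf
  obtain ⟨G, hG, hG'⟩ := hg
  refine ⟨F * G, fun x => ?_, ?_⟩
  · rw [CircleDeg1Lift.mul_apply, hF, hG]
    rfl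
  · rw [CircleDeg1Lift.coe_mul]
    exact hF'.comp hG'

/-- `Diff^r(S¹)`: the group, under composition, of the orientation preserving `C^r`-diffeomorphisms
of the circle `S¹ = ℝ/ℤ` (homeomorphisms, for `r = 0`): the map and its inverse are of
class `C^r`. -/
def Diff (r : ℕ) : Subgroup (UnitAddCircle ≃ₜ UnitAddCircle) where
  carrier := {f | HasCrLift r f ∧ HasCrLift r f⁻¹}
  one_mem' := ⟨HasCrLift.one r, by simpa using HasCrLift.one r⟩
  mul_mem' hf hg := ⟨hf.1.mul hg.1, by simpa using hg.2.mul hf.2⟩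
  inv_mem' hf := ⟨hf.2, by simpa using hf.1⟩

/-- The space `Diff^1(S¹)`. -/
def Diff1 : Type := ↥(Diff 1)

/-- The underlying circle homeomorphism. -/
def Diff1.toHomeo (f : Diff1) : UnitAddCircle ≃ₜ UnitAddCircle := f.1

/-- A lift of `f` to the real line (unique up to the addition of an integer). -/
noncomputable def Diff1.lift (f : Diff1) : CircleDeg1Lift := Classical.choose f.2.1

theorem Diff1.isLift_lift (f : Diff1) : IsLift f.lift f.toHomeo :=
  (Classical.choose_spec f.2.1).1

theorem Diff1.contDiff_lift (f : Diff1) : ContDiff ℝ 1 f.lift :=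
  (Classical.choose_spec f.2.1).2

/-- Two continuous lifts of the same homeomorphism differ by an integer. In particular the two
definitions below, of the derivative and of the rotation number, do not depend on the lift. -/
theorem IsLift.exists_eq_add_int {F G : CircleDeg1Lift} {f : UnitAddCircle ≃ₜ UnitAddCircle}
    (hF : IsLift F f) (hG : IsLift G f) (hFc : Continuous F) (hGc : Continuous G) :
    ∃ n : ℤ, ∀ x, F x = G x + n := by
  have h : ∀ x, ∃ n : ℤ, F x - G x = n := by
    intro x
    have h1 : ((F x - G x : ℝ) : UnitAddCircle) = 0 := by
      rw [AddCircle.coe_sub, hF x, hG x, sub_self]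
    obtain ⟨n, hn⟩ := (AddCircle.coe_eq_zero_iff (1 : ℝ)).1 h1
    exact ⟨n, by simpa using hn.symm⟩
  choose n hn using h
  have hc : Continuous n := by
    rw [Int.isClosedEmbedding_coe_real.isEmbedding.continuous_iff]
    have : ((fun m : ℤ => (m : ℝ)) ∘ n) = fun x => F x - G x := funext fun x => (hn x).symm
    rw [this]
    exact hFc.sub hGc
  refine ⟨n 0, fun x => ?_⟩
  have h2 : n x = n 0 := PreconnectedSpace.constant inferInstance hc
  have h3 := hn x
  rw [h2] at h3
  linarith

/-- The derivative of `f`, as a (`1`-periodic) function of the angular coordinate `x ∈ ℝ`. -/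
noncomputable def Diff1.derivative (f : Diff1) : ℝ → ℝ := deriv f.lift

/-- The rotation number `ρ(f) ∈ ℝ/ℤ`: the class modulo `ℤ` of `lim Fⁿ(x)/n`, `F` a lift of `f`. -/
noncomputable def Diff1.rotationNumber (f : Diff1) : UnitAddCircle :=
  (f.lift.translationNumber : UnitAddCircle)

/-- The `C^1`-topology on `Diff^1(S¹)`: uniform convergence of the maps and of their derivatives. -/
noncomputable instance : TopologicalSpace Diff1 :=
  TopologicalSpace.induced
    (fun f => ((UniformFun.ofFun f.toHomeo : UnitAddCircle →ᵤ UnitAddCircle),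
      (UniformFun.ofFun f.derivative : ℝ →ᵤ ℝ))) inferInstance

/-- `F^1_α`: the set of the `C^1`-diffeomorphisms of the circle with rotation number `α`. -/
def rotationClass (α : UnitAddCircle) : Set Diff1 := {f | f.rotationNumber = α}

/-- The `C^r`-conjugacy class `{h f h⁻¹ : h ∈ Diff^r(S¹)}` of `f` in `Diff^1(S¹)`. (For `1 ≤ r` every
`h f h⁻¹` lies in `Diff^1(S¹)`; for `r = 0` only those which do are taken.) -/
def conjClass (r : ℕ) (f : Diff1) : Set Diff1 :=
  {g | ∃ h ∈ Diff r, g.toHomeo = h * f.toHomeo * h⁻¹}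

end CircleDiffeo

namespace CircleDiffeo

open Set Filter MeasureTheory

/-! ### Continuous periodic functions -/

/-! Let F and G be lifts with the same irrational translation number α. The point is to find a
smooth H with H F H⁻¹ close to G in C¹; the rotation R by α serves as a relay.

From F to R. The derivative of Fⁿ is the exponential of a Birkhoff sum of log F'. Comparing orbits
through a monotone semiconjugacy to R shows that these sums differ by o(n), uniformly in the
starting points. One of them vanishes, since Fⁿ has mean slope 1 over a period, so all are o(n)
(`abs_sum_log_deriv_le`). The mean W of the first n sums satisfies W∘F - W + log F' = o(1). Hence a
coordinate φ with φ' proportional to exp W makes the derivative of φ F φ⁻¹ close to 1, and φ F φ⁻¹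
is then close to R (`exists_conj_near_rotation`).

From R to G. Perturb G to class C² without changing its rotation number. Denjoy's theorem
(`strictMono_semiconj`) gives a homeomorphism P with P R = G P. Let X t be the mean of P over [t, t
+ β]. Its derivative is a difference quotient of P, so X'(t + α) / X' t is a slope of G over a short
interval containing X t, and X R X⁻¹ is C¹-close to G (`exists_conj_rotation_near`).

Then H = X φ works, with φ chosen after X (`exists_conj_near`). A C¹-small change of H moves H F H⁻¹
little in C¹, so H can be smoothed to any class C^r. The inclusion in the rotation class is the
invariance of the rotation number under topological conjugacy. -/

theorem uniformContinuous_of_periodic {φ : ℝ → ℝ} (hc : Continuous φ)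
    (hp : Function.Periodic φ 1) : UniformContinuous φ := by
  have h := isCompact_Icc (a := (-1 : ℝ)) (b := 2) |>.uniformContinuousOn_of_continuous
    hc.continuousOn
  rw [Metric.uniformContinuousOn_iff] at h
  rw [Metric.uniformContinuous_iff]
  intro ε hε
  obtain ⟨δ, hδ, h⟩ := h ε hε
  -- Translating by ⌊s⌋ puts s in [0, 1), and t at distance less than 1 from it stays in [-1, 2].
  refine ⟨min δ 1, lt_min hδ one_pos, fun {s t} hst => ?_⟩
  have h1 : φ s = φ (s - ⌊s⌋) := by simpa using (hp.sub_int_mul_eq ⌊s⌋ (x := s)).symm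
  have h2 : φ t = φ (t - ⌊s⌋) := by simpa using (hp.sub_int_mul_eq ⌊s⌋ (x := t)).symm
  rw [h1, h2]
  have h3 := Int.floor_le s
  have h4 := Int.lt_floor_add_one s
  have h5 := hst.trans_le (min_le_right _ _)
  have h6 := hst.trans_le (min_le_left _ _)
  rw [Real.dist_eq, abs_lt] at h5
  refine h _ ⟨by linarith, by linarith⟩ _ ⟨by linarith, by linarith⟩ ?_
  rwa [dist_sub_right]

theorem exists_bound_of_periodic {φ : ℝ → ℝ} (hc : Continuous φ)
    (hp : Function.Periodic φ 1) : ∃ M, 0 < M ∧ ∀ x, |φ x| ≤ M := by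
  obtain ⟨M, hM⟩ := (hp.isBounded_of_continuous one_ne_zero hc).exists_norm_le
  refine ⟨max M 1, by positivity, fun x => (hM _ (mem_range_self x)).trans (le_max_left _ _)⟩

theorem exists_lower_bound_of_periodic {φ : ℝ → ℝ} (hc : Continuous φ)
    (hp : Function.Periodic φ 1) (h0 : ∀ x, 0 < φ x) : ∃ m, 0 < m ∧ ∀ x, m ≤ φ x := by
  obtain ⟨M, hM, h⟩ := exists_bound_of_periodic (φ := fun x => (φ x)⁻¹)
    (hc.inv₀ fun x => (h0 x).ne') (fun x => by simp [hp x])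
  refine ⟨M⁻¹, by positivity, fun x => ?_⟩
  have := (le_abs_self _).trans (h x)
  exact inv_le_of_inv_le₀ (h0 x) this

/-- A continuous periodic function is Lipschitz up to an arbitrarily small additive error. -/
theorem exists_abs_sub_le_add_mul {φ : ℝ → ℝ} (hc : Continuous φ)
    (hp : Function.Periodic φ 1) {ε : ℝ} (hε : 0 < ε) :
    ∃ K, 0 ≤ K ∧ ∀ s t, |φ s - φ t| ≤ ε + K * |s - t| := by
  obtain ⟨δ, hδ, h⟩ := Metric.uniformContinuous_iff.1 (uniformContinuous_of_periodic hc hp) ε hε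
  obtain ⟨M, hM, hb⟩ := exists_bound_of_periodic hc hp
  refine ⟨2 * M / δ, by positivity, fun s t => ?_⟩
  rcases lt_or_ge |s - t| δ with hst | hst
  · have h1 : |φ s - φ t| < ε := h hst
    have : 0 ≤ 2 * M / δ * |s - t| := by positivity
    linarith
  · have h1 : |φ s - φ t| ≤ 2 * M := by
      have := abs_sub (φ s) (φ t)
      linarith [hb s, hb t]
    have h2 : 2 * M ≤ 2 * M / δ * |s - t| := by
      rw [div_mul_eq_mul_div, le_div_iff₀ hδ]
      gcongr
    linarith

/-! ### Arithmetic of an irrational rotation -/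

theorem exists_lt_abs_mul_sub {α : ℝ} (hα : Irrational α) (N : ℕ) :
    ∃ τ, 0 < τ ∧ ∀ i : ℕ, 0 < i → i < N → ∀ k : ℤ, τ < |i * α - k| := by
  induction N with
  | zero => exact ⟨1, one_pos, fun i _ h => absurd h (Nat.not_lt_zero i)⟩
  | succ N ih =>
    obtain ⟨τ, hτ, h⟩ := ih
    rcases Nat.eq_zero_or_pos N with rfl | hN
    · exact ⟨1, one_pos, fun i h1 h2 => by omega⟩
    have hirr : Irrational (N * α) := hα.natCast_mul hN.ne'
    have hpos : 0 < |N * α - round (N * α)| := abs_pos.2 (sub_ne_zero.2 (hirr.ne_int _))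
    refine ⟨min τ (|N * α - round (N * α)| / 2), by positivity, fun i h0 hi k => ?_⟩
    rcases Nat.lt_succ_iff_lt_or_eq.1 hi with hi | rfl
    · exact (min_le_left _ _).trans_lt (h i h0 hi k)
    · refine (min_le_right _ _).trans_lt ((half_lt_self hpos).trans_le ?_)
      exact round_le _ _

/-- Denominators below N keep their multiples of α at distance more than τ from the integers, so a
Dirichlet approximation with error below τ must have a larger denominator. -/
theorem exists_dirichlet_approx {α : ℝ} (hα : Irrational α) (N : ℕ) :
    ∃ (p : ℤ) (q : ℕ), N ≤ q ∧ 0 < q ∧ IsCoprime p q ∧ |q * α - p| < 1 / q := by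
  obtain ⟨τ, hτ, h⟩ := exists_lt_abs_mul_sub hα N
  obtain ⟨n, hn⟩ := exists_nat_one_div_lt hτ
  obtain ⟨r, hr, hrn⟩ := Real.exists_rat_abs_sub_le_and_den_le α n.succ_pos
  have hd : (0 : ℝ) < r.den := by exact_mod_cast r.den_pos
  have hd' : (r.den : ℝ) ≤ n + 1 := by exact_mod_cast hrn
  have key : |r.den * α - r.num| ≤ 1 / (n + 1 + 1) := by
    have h1 : r.den * α - r.num = r.den * (α - r) := by
      have : (r : ℝ) = r.num / r.den := by exact_mod_cast (Rat.num_div_den r).symm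
      rw [this]
      field_simp
    rw [h1, abs_mul, abs_of_pos hd]
    calc (r.den : ℝ) * |α - r| ≤ r.den * (1 / (((n.succ : ℕ) + 1) * r.den)) := by gcongr
      _ = 1 / (n + 1 + 1) := by push_cast; field_simp
  refine ⟨r.num, r.den, ?_, r.den_pos, Rat.isCoprime_num_den r, ?_⟩
  · by_contra! hlt
    have h2 := h r.den r.den_pos hlt r.num
    have h3 : (1 : ℝ) / (n + 1 + 1) ≤ 1 / (n + 1) := by gcongr; linarith
    linarith
  · refine key.trans_lt ?_
    rw [one_div_lt_one_div (by positivity) hd]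
    linarith

theorem exists_lt_mul_add_mul_eq {p : ℤ} {q : ℕ} (hq : 0 < q) (h : IsCoprime p q) (m : ℤ) :
    ∃ (a : ℕ) (b : ℤ), a < q ∧ a * p + b * q = m := by
  obtain ⟨u, v, huv⟩ := h
  have hq' : (0 : ℤ) < q := by exact_mod_cast hq
  have h0 := Int.emod_nonneg (m * u) hq'.ne'
  have h1 := Int.emod_lt_of_pos (m * u) hq'
  have h2 := Int.emod_add_mul_ediv (m * u) q
  refine ⟨((m * u) % q).toNat, m * v + p * (m * u / q), by omega, ?_⟩
  rw [Int.toNat_of_nonneg h0]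
  linear_combination p * h2 + m * huv

theorem abs_mul_sub_mul_div_lt {α : ℝ} {p : ℤ} {q : ℕ} (hq : 0 < q)
    (h : |q * α - p| < 1 / q) {i : ℕ} (hi : i < q) : |i * α - i * p / q| < 1 / q := by
  have hq' : (0 : ℝ) < q := by exact_mod_cast hq
  have h1 : i * α - i * p / q = i / q * (q * α - p) := by field_simp
  have h2 : (i : ℝ) / q < 1 := by rw [div_lt_one hq']; exact_mod_cast hi
  rw [h1, abs_mul, abs_of_nonneg (by positivity)]
  have h3 := abs_nonneg (q * α - p)
  nlinarith [show (0 : ℝ) ≤ i / q by positivity]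

/-- The first `q` multiples of `α` come within `3 / q` below every point of the circle. -/
theorem exists_mul_add_near {α : ℝ} {p : ℤ} {q : ℕ} (hq : 0 < q) (hc : IsCoprime p q)
    (h : |q * α - p| < 1 / q) (t : ℝ) :
    ∃ (a : ℕ) (b : ℤ), a < q ∧ 0 < t - (a * α + b) ∧ t - (a * α + b) < 3 / q := by
  have hq' : (0 : ℝ) < q := by exact_mod_cast hq
  -- The numerator is one less than ⌊t q⌋, so that replacing p / q by α, an error below 1 / q,
  -- leaves the point below t.
  obtain ⟨a, b, ha, hab⟩ := exists_lt_mul_add_mul_eq hq hc (⌊t * q⌋ - 1)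
  refine ⟨a, b, ha, ?_⟩
  have h1 := abs_lt.1 (abs_mul_sub_mul_div_lt hq h ha)
  have h2 : (a : ℝ) * p / q + b = (⌊t * q⌋ - 1) / q := by
    have : (a : ℝ) * p + b * q = ⌊t * q⌋ - 1 := by exact_mod_cast hab
    rw [← this]
    field_simp
  have h3 := Int.floor_le (t * q)
  have h4 := Int.lt_floor_add_one (t * q)
  have h5 : t - (⌊t * q⌋ - 1) / q = (t * q - ⌊t * q⌋ + 1) / q := by field_simp; ring
  have h6 : 1 / (q : ℝ) ≤ (t * q - ⌊t * q⌋ + 1) / q := by gcongr; linarith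
  have h7 : (t * q - ⌊t * q⌋ + 1) / q < 2 / (q : ℝ) := by gcongr; linarith
  have h8 : (3 : ℝ) / q = 2 / q + 1 / q := by ring
  constructor <;> linarith [h1.1, h1.2]

/-- By coprimality i p / q is at least 1 / q away from the integers, and for i ≤ q / 2 it differs
from i α by less than 1 / (2 q). -/
theorem half_div_lt_abs_mul_sub {α : ℝ} {p : ℤ} {q : ℕ} (hc : IsCoprime p q)
    (h : |q * α - p| < 1 / q) {i : ℕ} (hi : 0 < i) (hiq : 2 * i ≤ q) (k : ℤ) :
    1 / (2 * q) < |i * α - k| := by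
  have hq : 0 < q := by omega
  have hq' : (0 : ℝ) < q := by exact_mod_cast hq
  have hne : (i : ℤ) * p - k * q ≠ 0 := by
    intro h0
    have h1 : (q : ℤ) ∣ i * p := ⟨k, by linarith⟩
    have h2 : (q : ℤ) ∣ i := hc.symm.dvd_of_dvd_mul_right h1
    have := Int.le_of_dvd (by exact_mod_cast hi) h2
    omega
  have h1 : (1 : ℝ) / q ≤ |(i : ℝ) * p / q - k| := by
    have : (1 : ℝ) ≤ |(i : ℝ) * p - k * q| := by exact_mod_cast Int.one_le_abs hne
    have h2 : (i : ℝ) * p / q - k = (i * p - k * q) / q := by field_simp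
    rw [h2, abs_div, abs_of_pos hq']
    gcongr
  have h2 : |i * α - i * p / q| < 1 / (2 * q) := by
    have h1 : i * α - i * p / q = i / q * (q * α - p) := by field_simp
    have h2 : (i : ℝ) / q ≤ 1 / 2 := by
      rw [div_le_div_iff₀ hq' two_pos]; exact_mod_cast (by omega : i * 2 ≤ 1 * q)
    have hi' : (0 : ℝ) < i / q := by positivity
    rw [h1, abs_mul, abs_of_pos hi']
    calc (i : ℝ) / q * |q * α - p| < i / q * (1 / q) := by gcongr
      _ ≤ 1 / 2 * (1 / q) := by gcongr
      _ = 1 / (2 * q) := by field_simp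
  have h3 : (1 : ℝ) / q = 1 / (2 * q) + 1 / (2 * q) := by field_simp; ring
  have h4 := abs_sub_abs_le_abs_sub (i * p / q - k : ℝ) (i * p / q - i * α)
  have h5 : (i * p / q - k : ℝ) - (i * p / q - i * α) = i * α - k := by ring
  rw [h5, abs_sub_comm (i * p / q : ℝ) (i * α)] at h4
  linarith

/-! ### The semiconjugacy to a rotation -/

/-- At this stage π is only monotone. Continuity follows from irrationality in
`continuous_of_semiconj`; injectivity needs Denjoy's theorem. -/
theorem exists_semiconj_rotation {F : CircleDeg1Lift} (hF : Function.Bijective F) :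
    ∃ π : CircleDeg1Lift, ∀ x, π (F x) = π x + F.translationNumber := by
  set R := CircleDeg1Lift.translate (Multiplicative.ofAdd F.translationNumber)
  obtain ⟨π, hπ⟩ := CircleDeg1Lift.semiconj_of_bijective_of_translationNumber_eq
    (f₂ := (R : CircleDeg1Lift)) hF (CircleDeg1Lift.toOrderIso R).bijective
    (CircleDeg1Lift.translationNumber_translate _).symm
  refine ⟨π, fun x => ?_⟩
  rw [hπ x, CircleDeg1Lift.translate_apply, add_comm]

section Semiconj

variable {F π : CircleDeg1Lift} {α : ℝ}

theorem iterate_add_int (F : CircleDeg1Lift) (n : ℕ) (x : ℝ) (k : ℤ) :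
    F^[n] (x + k) = F^[n] x + k := by
  rw [← CircleDeg1Lift.coe_pow, CircleDeg1Lift.map_add_int]

theorem semiconj_iterate (hπ : ∀ x, π (F x) = π x + α) (n : ℕ) (x : ℝ) :
    π (F^[n] x) = π x + n * α := by
  induction n with
  | zero => simp
  | succ n ih => rw [Function.iterate_succ_apply', hπ, ih]; push_cast; ring

/-- A common point would, after applying π, place (j - i) α within π v - π u of an integer. -/
theorem disjoint_Ico_iterate (hπ : ∀ x, π (F x) = π x + α) {u v : ℝ} {i j : ℕ} (hij : i < j)
    (h : ∀ k : ℤ, π v - π u < |(j - i : ℕ) * α - k|) (k l : ℤ) :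
    Disjoint (Ico (F^[i] u - k) (F^[i] v - k)) (Ico (F^[j] u - l) (F^[j] v - l)) := by
  rw [Set.disjoint_left]
  rintro y ⟨h1, h2⟩ ⟨h3, h4⟩
  have e1 := π.monotone h1
  have e2 := π.monotone h2.le
  have e3 := π.monotone h3
  have e4 := π.monotone h4.le
  simp only [CircleDeg1Lift.map_sub_int, semiconj_iterate hπ] at e1 e2 e3 e4
  have := h (l - k)
  rw [Nat.cast_sub hij.le] at this
  push_cast at this
  refine absurd this (not_lt.2 (abs_le.2 ⟨?_, ?_⟩)) <;> linarith

/-- Intervals whose first `N` images are disjoint on the circle have images of total length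
at most `2`. -/
theorem sum_iterate_sub_le_two (hπ : ∀ x, π (F x) = π x + α) {u v : ℝ} {N : ℕ} (huv : u ≤ v)
    (hvu : v ≤ u + 1)
    (h : ∀ i : ℕ, 0 < i → i < N → ∀ k : ℤ, π v - π u < |i * α - k|) :
    ∑ i ∈ Finset.range N, (F^[i] v - F^[i] u) ≤ 2 := by
  -- Each image, of length at most 1, is translated to start in [0, 1). The translates are disjoint
  -- subsets of [0, 2), whose measure is the bound.
  set I : ℕ → Set ℝ := fun i => Ico (F^[i] u - ⌊F^[i] u⌋) (F^[i] v - ⌊F^[i] u⌋) with hI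
  have hmono : ∀ i, F^[i] u ≤ F^[i] v := fun i => F.monotone.iterate i huv
  have hsub : (⋃ i ∈ Finset.range N, I i) ⊆ Ico (0 : ℝ) 2 := by
    refine Set.iUnion₂_subset fun i _ => ?_
    refine Ico_subset_Ico (sub_nonneg.2 (Int.floor_le _)) ?_
    have h1 := F.monotone.iterate i hvu
    have h2 := iterate_add_int F i u 1
    have h3 := Int.lt_floor_add_one (F^[i] u)
    push_cast at h2
    linarith
  have hdisj : Set.PairwiseDisjoint (↑(Finset.range N)) I := by
    have key : ∀ i j, i < j → j < N → Disjoint (I i) (I j) := fun i j hij hj =>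
      disjoint_Ico_iterate hπ hij (fun k => h (j - i) (by omega) (by omega) k) _ _
    intro i hi j hj hij
    rcases lt_or_gt_of_ne hij with hlt | hlt
    · exact key i j hlt (by simpa using hj)
    · exact (key j i hlt (by simpa using hi)).symm
  have hvol := measure_mono (μ := volume) hsub
  rw [measure_biUnion_finset hdisj fun i _ => measurableSet_Ico] at hvol
  simp only [hI, Real.volume_Ico, sub_zero, sub_sub_sub_cancel_right] at hvol
  rw [← ENNReal.ofReal_sum_of_nonneg fun i _ => sub_nonneg.2 (hmono i)] at hvol
  exact (ENNReal.ofReal_le_ofReal_iff zero_le_two).1 hvol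

/-- The increment π v - π u is unchanged by F, so the bound 2 applies to each block of N consecutive
iterates. -/
theorem sum_iterate_sub_le_blocks (hπ : ∀ x, π (F x) = π x + α) {u v : ℝ} {N : ℕ} (huv : u ≤ v)
    (hvu : v ≤ u + 1)
    (h : ∀ i : ℕ, 0 < i → i < N → ∀ k : ℤ, π v - π u < |i * α - k|) (m : ℕ) :
    ∑ i ∈ Finset.range (N * m), (F^[i] v - F^[i] u) ≤ 2 * m := by
  induction m with
  | zero => simp
  | succ m ih =>
    rw [Nat.mul_succ, Finset.sum_range_add]
    have h1 := sum_iterate_sub_le_two (N := N) hπ (F.monotone.iterate (N * m) huv)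
      (by
        have h2 := F.monotone.iterate (N * m) hvu
        have h3 := iterate_add_int F (N * m) u 1
        push_cast at h3
        linarith)
      (by
        simp only [semiconj_iterate hπ]
        simpa using h)
    simp only [← Function.iterate_add_apply] at h1
    simp only [add_comm (N * m)]
    push_cast
    linarith

theorem sum_iterate_sub_le_div (hπ : ∀ x, π (F x) = π x + α) {u v : ℝ} {N : ℕ} (hN : 0 < N)
    (huv : u ≤ v) (hvu : v ≤ u + 1)
    (h : ∀ i : ℕ, 0 < i → i < N → ∀ k : ℤ, π v - π u < |i * α - k|) (n : ℕ) :
    ∑ i ∈ Finset.range n, (F^[i] v - F^[i] u) ≤ 2 * (n / N + 1) := by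
  have h1 := sum_iterate_sub_le_blocks hπ huv hvu h (n / N + 1)
  have h2 : n ≤ N * (n / N + 1) := by
    have := Nat.div_add_mod n N
    have := Nat.mod_lt n hN
    rw [Nat.mul_succ]
    omega
  have h3 : ∑ i ∈ Finset.range n, (F^[i] v - F^[i] u) ≤
      ∑ i ∈ Finset.range (N * (n / N + 1)), (F^[i] v - F^[i] u) :=
    Finset.sum_le_sum_of_subset_of_nonneg (Finset.range_mono h2)
      fun i _ _ => sub_nonneg.2 (F.monotone.iterate i huv)
  have h4 : ((n / N : ℕ) : ℝ) ≤ n / N := Nat.cast_div_le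
  push_cast at h1
  linarith

/-- Birkhoff sums of a continuous function over a circle homeomorphism with irrational rotation
number become uniformly close, on average, to one another. -/
theorem birkhoff_sum_sub_le (hπ : ∀ x, π (F x) = π x + α) (hα : Irrational α) {φ : ℝ → ℝ}
    (hc : Continuous φ) (hp : Function.Periodic φ 1) {ε : ℝ} (hε : 0 < ε) :
    ∃ n₀ : ℕ, ∀ n ≥ n₀, ∀ x y,
      |∑ i ∈ Finset.range n, φ (F^[i] x) - ∑ i ∈ Finset.range n, φ (F^[i] y)| ≤ ε * n := by
  obtain ⟨K, hK, hφ⟩ := exists_abs_sub_le_add_mul hc hp (half_pos hε)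
  obtain ⟨M, hM, hb⟩ := exists_bound_of_periodic hc hp
  -- The final error is at most ε n / 2 + 2 K n / N + (2 K + 2 M q): this N makes the second term at
  -- most ε n / 4, and n₀ does the same for the last.
  obtain ⟨N, hN⟩ := exists_nat_gt (8 * K / ε)
  have hN0 : 0 < N := by
    have : (0 : ℝ) < N := lt_of_le_of_lt (by positivity) hN
    exact_mod_cast this
  have hN0' : (0 : ℝ) < N := by exact_mod_cast hN0
  obtain ⟨τ, hτ, hsep⟩ := exists_lt_abs_mul_sub hα N
  -- The gap π y - π u will be below 3 / q: less than τ for the disjointness of N images, less than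
  -- 1 for y ≤ u + 1.
  obtain ⟨q₀, hq₀⟩ := exists_nat_gt (3 / min τ 1)
  obtain ⟨p, q, hq1, hq, hcop, happ⟩ := exists_dirichlet_approx hα q₀
  have hq' : (0 : ℝ) < q := by exact_mod_cast hq
  have h3q : 3 / (q : ℝ) < min τ 1 := by
    have : (q₀ : ℝ) ≤ q := by exact_mod_cast hq1
    rw [div_lt_comm₀ hq' (by positivity)]
    linarith
  obtain ⟨n₀, hn₀⟩ := exists_nat_gt ((2 * K + 2 * M * q) / (ε / 4))
  refine ⟨n₀, fun n hn x y => ?_⟩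
  obtain ⟨a, b, ha, h1, h2⟩ := exists_mul_add_near hq hcop happ (π y - π x)
  set u := F^[a] x + b with hu
  have hπu : π u = π x + a * α + b := by
    rw [hu, CircleDeg1Lift.map_add_int, semiconj_iterate hπ]
  have huy : u ≤ y := (π.monotone.reflect_lt (by linarith)).le
  have hyu : y ≤ u + 1 := by
    refine (π.monotone.reflect_lt ?_).le
    rw [CircleDeg1Lift.map_add_one]
    linarith [h3q.trans_le (min_le_right _ _)]
  have hs := sum_iterate_sub_le_div hπ hN0 huy hyu
    (fun i hi hiN k => by
      have := hsep i hi hiN k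
      linarith [h3q.trans_le (min_le_left _ _)]) n
  have huy_sum : |∑ i ∈ Finset.range n, φ (F^[i] u) - ∑ i ∈ Finset.range n, φ (F^[i] y)| ≤
      ε / 2 * n + K * (2 * (n / N + 1)) := by
    rw [← Finset.sum_sub_distrib]
    refine (Finset.abs_sum_le_sum_abs _ _).trans ?_
    calc ∑ i ∈ Finset.range n, |φ (F^[i] u) - φ (F^[i] y)|
        ≤ ∑ i ∈ Finset.range n, (ε / 2 + K * (F^[i] y - F^[i] u)) := by
          refine Finset.sum_le_sum fun i _ => ?_
          have := hφ (F^[i] u) (F^[i] y)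
          rwa [abs_sub_comm (F^[i] u), abs_of_nonneg (sub_nonneg.2 (F.monotone.iterate i huy))]
            at this
      _ = ε / 2 * n + K * ∑ i ∈ Finset.range n, (F^[i] y - F^[i] u) := by
          rw [Finset.sum_add_distrib, ← Finset.mul_sum]
          simp [mul_comm]
      _ ≤ _ := by gcongr
  -- The orbit of u is that of x delayed by a < q steps, up to an integer, so only a terms at each
  -- end differ.
  have hxu_sum : |∑ i ∈ Finset.range n, φ (F^[i] x) - ∑ i ∈ Finset.range n, φ (F^[i] u)| ≤
      2 * M * q := by
    have e1 : ∀ i, φ (F^[i] u) = φ (F^[a + i] x) := fun i => by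
      rw [hu, iterate_add_int, ← Function.iterate_add_apply, add_comm i a]
      simpa using hp.int_mul b (F^[a + i] x)
    simp only [e1]
    have e2 := Finset.sum_range_add (fun i => φ (F^[i] x)) a n
    have e3 := Finset.sum_range_add (fun i => φ (F^[i] x)) n a
    rw [add_comm n a] at e3
    have e4 : ∑ i ∈ Finset.range n, φ (F^[i] x) - ∑ i ∈ Finset.range n, φ (F^[a + i] x) =
        ∑ i ∈ Finset.range a, φ (F^[i] x) - ∑ i ∈ Finset.range a, φ (F^[n + i] x) := by linarith
    rw [e4, ← Finset.sum_sub_distrib]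
    refine (Finset.abs_sum_le_sum_abs _ _).trans ?_
    calc ∑ i ∈ Finset.range a, |φ (F^[i] x) - φ (F^[n + i] x)|
        ≤ ∑ i ∈ Finset.range a, 2 * M := by
          refine Finset.sum_le_sum fun i _ => ?_
          have := abs_sub (φ (F^[i] x)) (φ (F^[n + i] x))
          linarith [hb (F^[i] x), hb (F^[n + i] x)]
      _ = 2 * M * a := by simp [mul_comm]
      _ ≤ 2 * M * q := by
          have : (a : ℝ) ≤ q := by exact_mod_cast ha.le
          gcongr
  have hfin : 2 * K + 2 * M * q ≤ ε / 4 * n := by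
    have : (n₀ : ℝ) ≤ n := by exact_mod_cast hn
    rw [div_lt_iff₀ (by positivity)] at hn₀
    nlinarith
  have hKN : K * (2 * (n / N)) ≤ ε / 4 * n := by
    rw [div_lt_iff₀ hε] at hN
    rw [mul_div_assoc', mul_div_assoc', div_le_iff₀ hN0']
    nlinarith [(Nat.cast_nonneg n : (0 : ℝ) ≤ n)]
  have := abs_sub_le (∑ i ∈ Finset.range n, φ (F^[i] x)) (∑ i ∈ Finset.range n, φ (F^[i] u))
    (∑ i ∈ Finset.range n, φ (F^[i] y))
  linarith

end Semiconj

/-! ### Lifts of `C^1`-diffeomorphisms -/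

/-- `F` is a lift of an orientation preserving `C^1`-diffeomorphism of the circle. -/
def IsDiffeoLift (F : CircleDeg1Lift) : Prop :=
  ContDiff ℝ 1 F ∧ ∀ x, 0 < deriv F x

namespace IsDiffeoLift

variable {F G : CircleDeg1Lift}

theorem of_hasDerivAt {w : ℝ → ℝ} (hw : Continuous w) (h0 : ∀ x, 0 < w x)
    (h : ∀ x, HasDerivAt F (w x) x) : IsDiffeoLift F := by
  have e : deriv F = w := funext fun x => (h x).deriv
  refine ⟨contDiff_one_iff_deriv.2 ⟨fun x => (h x).differentiableAt, e ▸ hw⟩, fun x => ?_⟩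
  rw [e]
  exact h0 x

theorem differentiable (hF : IsDiffeoLift F) : Differentiable ℝ F :=
  hF.1.differentiable one_ne_zero

theorem hasDerivAt (hF : IsDiffeoLift F) (x : ℝ) : HasDerivAt F (deriv F x) x :=
  (hF.differentiable x).hasDerivAt

theorem continuous (hF : IsDiffeoLift F) : Continuous F := hF.1.continuous

theorem strictMono (hF : IsDiffeoLift F) : StrictMono F := strictMono_of_deriv_pos hF.2

theorem bijective (hF : IsDiffeoLift F) : Function.Bijective F :=
  ⟨hF.strictMono.injective, F.continuous_iff_surjective.1 hF.continuous⟩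

theorem continuous_deriv (hF : IsDiffeoLift F) : Continuous (deriv F) :=
  hF.1.continuous_deriv le_rfl

theorem _root_.CircleDeg1Lift.periodic_deriv (F : CircleDeg1Lift) :
    Function.Periodic (deriv F) 1 := by
  intro x
  rw [← deriv_comp_add_const]
  have : (fun y => F (y + 1)) = fun y => F y + 1 := funext F.map_add_one
  rw [this, deriv_add_const]

theorem continuous_log_deriv (hF : IsDiffeoLift F) :
    Continuous fun x => Real.log (deriv F x) :=
  hF.continuous_deriv.log fun x => (hF.2 x).ne'

theorem periodic_log_deriv (F : CircleDeg1Lift) :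
    Function.Periodic (fun x => Real.log (deriv F x)) 1 := fun x => by
  simp only [F.periodic_deriv x]

theorem mul (hF : IsDiffeoLift F) (hG : IsDiffeoLift G) : IsDiffeoLift (F * G) := by
  refine of_hasDerivAt (w := fun x => deriv F (G x) * deriv G x)
    ((hF.continuous_deriv.comp hG.continuous).mul hG.continuous_deriv)
    (fun x => mul_pos (hF.2 _) (hG.2 _)) fun x => ?_
  rw [CircleDeg1Lift.coe_mul]
  exact (hF.hasDerivAt (G x)).comp x (hG.hasDerivAt x)

theorem deriv_mul (hF : IsDiffeoLift F) (hG : IsDiffeoLift G) (x : ℝ) :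
    deriv (F * G : CircleDeg1Lift) x = deriv F (G x) * deriv G x := by
  rw [CircleDeg1Lift.coe_mul]
  exact ((hF.hasDerivAt (G x)).comp x (hG.hasDerivAt x)).deriv

theorem hasDerivAt_iterate (hF : IsDiffeoLift F) (n : ℕ) (x : ℝ) :
    HasDerivAt F^[n] (Real.exp (∑ i ∈ Finset.range n, Real.log (deriv F (F^[i] x)))) x := by
  induction n with
  | zero => simpa using hasDerivAt_id x
  | succ n ih =>
    rw [Function.iterate_succ', Finset.sum_range_succ, Real.exp_add, Real.exp_log (hF.2 _),
      mul_comm]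
    exact (hF.hasDerivAt _).comp x ih

theorem continuous_iterate (hF : IsDiffeoLift F) (n : ℕ) : Continuous F^[n] :=
  hF.continuous.iterate n

/-- The iterates of a `C^1`-diffeomorphism with irrational rotation number have derivatives which
neither grow nor decay exponentially fast. -/
theorem abs_sum_log_deriv_le (hF : IsDiffeoLift F) (hα : Irrational F.translationNumber)
    {ε : ℝ} (hε : 0 < ε) : ∃ n₀ : ℕ, ∀ n ≥ n₀, ∀ x,
      |∑ i ∈ Finset.range n, Real.log (deriv F (F^[i] x))| ≤ ε * n := by
  obtain ⟨π, hπ⟩ := exists_semiconj_rotation hF.bijective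
  obtain ⟨n₀, h⟩ := birkhoff_sum_sub_le hπ hα hF.continuous_log_deriv (periodic_log_deriv F) hε
  refine ⟨n₀, fun n hn x => ?_⟩
  -- The mean slope of the iterate over a period is 1, so its derivative is 1 at some y and the sum
  -- at y vanishes.
  obtain ⟨y, -, hy⟩ := exists_hasDerivAt_eq_slope F^[n] _ zero_lt_one
    (hF.continuous_iterate n).continuousOn fun y _ => hF.hasDerivAt_iterate n y
  have h1 : F^[n] 1 = F^[n] 0 + 1 := by simpa using iterate_add_int F n 0 1
  have h2 : ∑ i ∈ Finset.range n, Real.log (deriv F (F^[i] y)) = 0 := by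
    rw [h1] at hy
    simpa using hy
  simpa [h2] using h n hn x y

end IsDiffeoLift

/-! ### Conjugates close to a rotation -/

theorem exists_lift_of_density {w : ℝ → ℝ} (hw : Continuous w) (hp : Function.Periodic w 1)
    (h0 : ∀ x, 0 < w x) :
    ∃ H : CircleDeg1Lift, ∃ c, 0 < c ∧ ∀ x, HasDerivAt H (c * w x) x := by
  have hI : 0 < ∫ t in (0 : ℝ)..1, w t :=
    intervalIntegral.intervalIntegral_pos_of_pos (hw.intervalIntegrable _ _) h0 zero_lt_one
  set c := (∫ t in (0 : ℝ)..1, w t)⁻¹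
  have hd : ∀ x, HasDerivAt (fun x => c * ∫ t in (0 : ℝ)..x, w t) (c * w x) x := fun x =>
    (intervalIntegral.integral_hasDerivAt_right (hw.intervalIntegrable _ _)
      (hw.stronglyMeasurableAtFilter _ _) hw.continuousAt).const_mul c
  have hc : 0 < c := inv_pos.2 hI
  refine ⟨⟨⟨fun x => c * ∫ t in (0 : ℝ)..x, w t, ?_⟩, fun x => ?_⟩, c, hc, hd⟩
  · refine (strictMono_of_deriv_pos fun x => ?_).monotone
    rw [(hd x).deriv]
    exact mul_pos hc (h0 x)
  · change c * ∫ t in (0 : ℝ)..(x + 1), w t = c * (∫ t in (0 : ℝ)..x, w t) + 1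
    rw [← intervalIntegral.integral_add_adjacent_intervals (hw.intervalIntegrable 0 x)
      (hw.intervalIntegrable x (x + 1)), hp.intervalIntegral_add_eq x 0, zero_add, mul_add]
    congr 1
    exact inv_mul_cancel₀ hI.ne'

namespace IsDiffeoLift

variable {F : CircleDeg1Lift}

/-- If `φ F φ⁻¹` has derivative close to `1`, then it is uniformly close to a rotation. -/
theorem abs_conj_sub_le {φ : CircleDeg1Lift} (hF : IsDiffeoLift F) (hφ : IsDiffeoLift φ) {ε : ℝ}
    (h : ∀ x, |deriv φ (F x) * deriv F x / deriv φ x - 1| ≤ ε) (x : ℝ) :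
    |φ (F x) - (φ x + F.translationNumber)| ≤ ε := by
  have hε : 0 ≤ ε := (abs_nonneg _).trans (h 0)
  obtain ⟨u, hu⟩ := CircleDeg1Lift.isUnit_iff_bijective.2 hφ.bijective
  have hcont : Continuous (u * F * (u⁻¹ : CircleDeg1Liftˣ) : CircleDeg1Lift) := by
    rw [CircleDeg1Lift.coe_mul, CircleDeg1Lift.coe_mul, hu]
    refine (hφ.continuous.comp hF.continuous).comp ?_
    have := (CircleDeg1Lift.toOrderIso u⁻¹).continuous
    rwa [CircleDeg1Lift.coe_toOrderIso] at this
  -- A continuous lift moves some point by exactly its translation number, which conjugation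
  -- preserves.
  obtain ⟨y, hy⟩ := CircleDeg1Lift.exists_eq_add_translationNumber _ hcont
  rw [CircleDeg1Lift.translationNumber_conj_eq, CircleDeg1Lift.mul_apply,
    CircleDeg1Lift.mul_apply, hu] at hy
  set z := (u⁻¹ : CircleDeg1Liftˣ) y with hz
  have hzy : y = φ z := by rw [hz, ← hu, CircleDeg1Lift.units_apply_inv_apply]
  rw [hzy] at hy
  set n := ⌊x - z⌋
  set z' := z + n with hz'
  have hy' : φ (F z') = φ z' + F.translationNumber := by
    rw [hz', CircleDeg1Lift.map_add_int, CircleDeg1Lift.map_add_int, CircleDeg1Lift.map_add_int, hy]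
    ring
  have h1 : z' ≤ x := by linarith [Int.floor_le (x - z)]
  have h2 : x ≤ z' + 1 := by linarith [Int.lt_floor_add_one (x - z)]
  have hd : ∀ t, HasDerivAt (fun s => φ (F s)) (deriv φ (F t) * deriv F t) t := fun t =>
    (hφ.hasDerivAt (F t)).comp t (hF.hasDerivAt t)
  have hratio : ∀ t, |deriv φ (F t) * deriv F t - deriv φ t| ≤ ε * deriv φ t := fun t => by
    have h3 := h t
    have h4 := hφ.2 t
    rwa [div_sub_one h4.ne', abs_div, abs_of_pos h4, div_le_iff₀ h4] at h3
  -- Both ε φ ± (φ∘F - φ) are monotone, and φ grows by at most 1 between z' and x, so the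
  -- displacement varies by at most ε from its exact value at z'.
  have m1 : Monotone fun s => φ (F s) - φ s + ε * φ s :=
    monotone_of_hasDerivAt_nonneg (fun t => ((hd t).sub (hφ.hasDerivAt t)).add
      ((hφ.hasDerivAt t).const_mul ε)) fun t => by
        simpa using by linarith [neg_le_of_abs_le (hratio t)]
  have m2 : Monotone fun s => ε * φ s - (φ (F s) - φ s) :=
    monotone_of_hasDerivAt_nonneg (fun t => ((hφ.hasDerivAt t).const_mul ε).sub
      ((hd t).sub (hφ.hasDerivAt t))) fun t => by
        simpa using by linarith [le_of_abs_le (hratio t)]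
  have e1 := m1 h1
  have e2 := m2 h1
  have e3 := φ.monotone h2
  have e4 := φ.monotone h1
  rw [φ.map_add_one] at e3
  simp only at e1 e2
  rw [abs_le]
  constructor <;> nlinarith

/-- Every `C^1`-diffeomorphism with irrational rotation number has `C^1`-conjugates which are
arbitrarily close to the rotation. -/
theorem exists_conj_near_rotation (hF : IsDiffeoLift F) (hα : Irrational F.translationNumber)
    {ε : ℝ} (hε : 0 < ε) : ∃ φ : CircleDeg1Lift, IsDiffeoLift φ ∧
      (∀ x, |deriv φ (F x) * deriv F x / deriv φ x - 1| ≤ ε) ∧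
      ∀ x, |φ (F x) - (φ x + F.translationNumber)| ≤ ε := by
  obtain ⟨δ, hδ, hexp⟩ : ∃ δ > 0, ∀ t : ℝ, |t| ≤ δ → |Real.exp t - 1| ≤ ε := by
    refine ⟨min (ε / 2) 1, by positivity, fun t ht => ?_⟩
    have h1 := Real.abs_exp_sub_one_le (ht.trans (min_le_right _ _))
    linarith [ht.trans (min_le_left _ _)]
  obtain ⟨n₀, hn₀⟩ := hF.abs_sum_log_deriv_le hα hδ
  set n := n₀ + 1
  have hn : (0 : ℝ) < n := by positivity
  set S : ℕ → ℝ → ℝ := fun j x => ∑ i ∈ Finset.range j, Real.log (deriv F (F^[i] x)) with hS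
  set W : ℝ → ℝ := fun x => 1 / n * ∑ j ∈ Finset.range n, S j x with hW
  have hSc : ∀ j, Continuous (S j) := fun j => continuous_finsetSum _ fun i _ =>
    hF.continuous_log_deriv.comp (hF.continuous_iterate i)
  have hSp : ∀ j, Function.Periodic (S j) 1 := fun j x => Finset.sum_congr rfl fun i _ => by
    have h1 : F^[i] (x + 1) = F^[i] x + 1 := by simpa using iterate_add_int F i x 1
    rw [h1]
    exact periodic_log_deriv F _
  have hWc : Continuous W := continuous_const.mul (continuous_finsetSum _ fun j _ => hSc j)
  have hWp : Function.Periodic W 1 := fun x => by simp only [hW, hSp _ x]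
  obtain ⟨φ, c, hc, hφ⟩ := exists_lift_of_density (w := fun x => Real.exp (W x))
    (Real.continuous_exp.comp hWc) (fun x => by simp only [hWp x]) fun x => Real.exp_pos _
  have hφ1 : IsDiffeoLift φ := .of_hasDerivAt
    (continuous_const.mul (Real.continuous_exp.comp hWc))
    (fun x => mul_pos hc (Real.exp_pos _)) hφ
  have key : ∀ x, |deriv φ (F x) * deriv F x / deriv φ x - 1| ≤ ε := fun x => by
    have hstep : ∀ j, S j (F x) + Real.log (deriv F x) = S (j + 1) x := fun j => by
      simp only [hS, Finset.sum_range_succ', Function.iterate_succ_apply, Function.iterate_zero,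
        id]
    -- Passing from the sums `S j` to the sums `S (j + 1)` only trades `S 0`, which is zero, for `S
    -- n`.
    have hcob : W (F x) + Real.log (deriv F x) - W x = 1 / n * S n x := by
      have h1 : ∑ j ∈ Finset.range n, S (j + 1) x = ∑ j ∈ Finset.range n, S j x + S n x := by
        have h2 := Finset.sum_range_succ (fun j => S j x) n
        rw [Finset.sum_range_succ'] at h2
        simpa [hS] using h2
      have h3 : ∑ j ∈ Finset.range n, S (j + 1) x =
          ∑ j ∈ Finset.range n, S j (F x) + n * Real.log (deriv F x) := by
        rw [← Finset.sum_congr rfl fun j _ => hstep j, Finset.sum_add_distrib]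
        simp
      have h4 : ∑ j ∈ Finset.range n, S j (F x) =
          ∑ j ∈ Finset.range n, S j x + S n x - n * Real.log (deriv F x) := by linarith
      simp only [hW, h4]
      field_simp
      ring
    have hquot : deriv φ (F x) * deriv F x / deriv φ x = Real.exp (1 / n * S n x) := by
      rw [(hφ _).deriv, (hφ _).deriv, ← hcob, Real.exp_sub, Real.exp_add, Real.exp_log (hF.2 x)]
      field_simp
    rw [hquot]
    refine hexp _ ?_
    rw [abs_mul, abs_of_pos (by positivity), div_mul_eq_mul_div, one_mul, div_le_iff₀ hn]
    exact hn₀ n (Nat.le_succ _) x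
  exact ⟨φ, hφ1, key, hF.abs_conj_sub_le hφ1 key⟩

end IsDiffeoLift

/-! ### Denjoy's theorem -/

section Denjoy

variable {F π : CircleDeg1Lift} {α : ℝ}

/-- The range contains π 0 + a α + b for all natural a and integers b, a dense set, and a monotone
map with dense range is continuous. -/
theorem continuous_of_semiconj (hπ : ∀ x, π (F x) = π x + α) (hα : Irrational α) :
    Continuous π := by
  refine π.monotone.continuous_of_denseRange (Metric.denseRange_iff.2 fun t r hr => ?_)
  obtain ⟨N, hN⟩ := exists_nat_gt (3 / r)
  obtain ⟨p, q, hNq, hq, hc, happ⟩ := exists_dirichlet_approx hα N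
  obtain ⟨a, b, -, h1, h2⟩ := exists_mul_add_near hq hc happ (t - π 0)
  have hq' : (0 : ℝ) < q := by exact_mod_cast hq
  have h3 : 3 / (q : ℝ) < r := by
    have : (N : ℝ) ≤ q := by exact_mod_cast hNq
    rw [div_lt_comm₀ hq' hr]
    linarith
  refine ⟨F^[a] 0 + b, ?_⟩
  rw [CircleDeg1Lift.map_add_int, semiconj_iterate hπ, Real.dist_eq, abs_of_pos (by linarith)]
  linarith

/-- The multiples i α with 0 < i ≤ q / 2 stay farther than 1 / (2 q) from the integers, so blocks of
length q / 2 + 1 are disjoint. Their length is at least q / 2, whence 2 (2 + 1) = 6. -/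
theorem sum_iterate_sub_le_six (hπ : ∀ x, π (F x) = π x + α) {p : ℤ} {q : ℕ} (hq : 0 < q)
    (hc : IsCoprime p q) (happ : |q * α - p| < 1 / q) {u v : ℝ} (huv : u ≤ v)
    (h : π v - π u ≤ 1 / (2 * q)) : ∑ i ∈ Finset.range q, (F^[i] v - F^[i] u) ≤ 6 := by
  have hq' : (1 : ℝ) ≤ q := by exact_mod_cast hq
  have hvu : v ≤ u + 1 := by
    refine (π.monotone.reflect_lt ?_).le
    have : 1 / (2 * (q : ℝ)) ≤ 1 / 2 := by gcongr; linarith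
    rw [CircleDeg1Lift.map_add_one]
    linarith
  have h1 := sum_iterate_sub_le_div (N := q / 2 + 1) hπ (Nat.succ_pos _) huv hvu
    (fun i hi hiN k => h.trans_lt (half_div_lt_abs_mul_sub hc happ hi (by omega) k)) q
  have h2 : (q : ℝ) / ((q / 2 + 1 : ℕ) : ℝ) ≤ 2 := by
    rw [div_le_iff₀ (by positivity)]
    exact_mod_cast (by omega : q ≤ 2 * (q / 2 + 1))
  linarith

/-- Continuity of π allows [u, v] to be cut into m + 1 pieces on each of which π grows by at most 1
/ (2 q). -/
theorem sum_iterate_sub_le_mul (hπ : ∀ x, π (F x) = π x + α) (hπc : Continuous π) {p : ℤ} {q : ℕ}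
    (hq : 0 < q) (hc : IsCoprime p q) (happ : |q * α - p| < 1 / q) (m : ℕ) {u v : ℝ}
    (huv : u ≤ v) (h : π v - π u ≤ (m + 1) / (2 * q)) :
    ∑ i ∈ Finset.range q, (F^[i] v - F^[i] u) ≤ 6 * (m + 1) := by
  have hq' : (0 : ℝ) < q := by exact_mod_cast hq
  induction m generalizing u with
  | zero => simpa using sum_iterate_sub_le_six hπ hq hc happ huv (by simpa using h)
  | succ m ih =>
    obtain ⟨w, ⟨hw1, hw2⟩, hw⟩ : ∃ w ∈ Icc u v, π w = min (π u + 1 / (2 * q)) (π v) := by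
      refine intermediate_value_Icc huv hπc.continuousOn ⟨le_min ?_ (π.monotone huv),
        min_le_right _ _⟩
      have : 0 < 1 / (2 * (q : ℝ)) := by positivity
      linarith
    have h1 := sum_iterate_sub_le_six hπ hq hc happ hw1 (by
      rw [hw]
      linarith [min_le_left (π u + 1 / (2 * q)) (π v)])
    have h2 := ih hw2 (by
      rw [hw]
      push_cast at h
      have e : ((m : ℝ) + 1 + 1) / (2 * q) = (m + 1) / (2 * q) + 1 / (2 * q) := by ring
      have e' : 0 ≤ ((m : ℝ) + 1) / (2 * q) := by positivity
      rcases min_choice (π u + 1 / (2 * q)) (π v) with h' | h' <;> rw [h'] <;> linarith)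
    have h3 : ∑ i ∈ Finset.range q, (F^[i] v - F^[i] u) =
        ∑ i ∈ Finset.range q, (F^[i] w - F^[i] u) + ∑ i ∈ Finset.range q, (F^[i] v - F^[i] w) := by
      rw [← Finset.sum_add_distrib]
      exact Finset.sum_congr rfl fun i _ => by ring
    push_cast
    linarith

theorem abs_sum_sub_sum_le (hπ : ∀ x, π (F x) = π x + α) (hπc : Continuous π) {p : ℤ} {q : ℕ}
    (hq : 0 < q) (hc : IsCoprime p q) (happ : |q * α - p| < 1 / q) {φ : ℝ → ℝ} {K : ℝ}
    (hK : 0 ≤ K) (hφ : ∀ x y, |φ x - φ y| ≤ K * |x - y|) (m : ℕ) {u v : ℝ}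
    (h : |π v - π u| ≤ (m + 1) / (2 * q)) {n : ℕ} (hn : n ≤ q) :
    |∑ i ∈ Finset.range n, φ (F^[i] v) - ∑ i ∈ Finset.range n, φ (F^[i] u)| ≤
      K * (6 * (m + 1)) := by
  wlog huv : u ≤ v generalizing u v
  · rw [abs_sub_comm]
    exact this (by rwa [abs_sub_comm]) (le_of_not_ge huv)
  rw [← Finset.sum_sub_distrib]
  have hnn : ∀ i, 0 ≤ F^[i] v - F^[i] u := fun i => sub_nonneg.2 (F.monotone.iterate i huv)
  calc |∑ i ∈ Finset.range n, (φ (F^[i] v) - φ (F^[i] u))|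
      ≤ ∑ i ∈ Finset.range n, K * (F^[i] v - F^[i] u) := by
        refine (Finset.abs_sum_le_sum_abs _ _).trans (Finset.sum_le_sum fun i _ => ?_)
        simpa only [abs_of_nonneg (hnn i)] using hφ (F^[i] v) (F^[i] u)
    _ ≤ ∑ i ∈ Finset.range q, K * (F^[i] v - F^[i] u) :=
        Finset.sum_le_sum_of_subset_of_nonneg (Finset.range_mono hn)
          fun i _ _ => mul_nonneg hK (hnn i)
    _ ≤ K * (6 * (m + 1)) := by
        rw [← Finset.mul_sum]
        gcongr
        exact sum_iterate_sub_le_mul hπ hπc hq hc happ m huv ((le_abs_self _).trans h)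

/-- The Denjoy–Koksma inequality for Lipschitz functions. -/
theorem denjoy_koksma (hπ : ∀ x, π (F x) = π x + α) (hπc : Continuous π) {p : ℤ} {q : ℕ}
    (hq : 0 < q) (hc : IsCoprime p q) (happ : |q * α - p| < 1 / q) {φ : ℝ → ℝ} {K : ℝ}
    (hp : Function.Periodic φ 1) (hK : 0 ≤ K) (hφ : ∀ x y, |φ x - φ y| ≤ K * |x - y|) (x y : ℝ) :
    |∑ i ∈ Finset.range q, φ (F^[i] x) - ∑ i ∈ Finset.range q, φ (F^[i] y)| ≤ 48 * K := by
  have hq' : (0 : ℝ) < q := by exact_mod_cast hq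
  have hint : ∀ (n : ℕ) (z : ℝ) (b : ℤ), ∑ i ∈ Finset.range n, φ (F^[i] (z + b)) =
      ∑ i ∈ Finset.range n, φ (F^[i] z) := fun n z b => Finset.sum_congr rfl fun i _ => by
    rw [iterate_add_int]
    simpa using hp.int_mul b (F^[i] z)
  -- 48 = 36 + 12. Replacing y by F^a x + b, within 3 / q = 6 / (2 q) under π, costs 36 K. Undoing
  -- the delay a compares a ≤ q terms along the orbits of x and F^q x - p, within 1 / q = 2 / (2 q),
  -- and costs 12 K.
  obtain ⟨a, b, ha, h1, h2⟩ := exists_mul_add_near hq hc happ (π y - π x)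
  have e1 := abs_sum_sub_sum_le hπ hπc hq hc happ hK hφ 5 (u := y) (v := F^[a] x + b) (by
    rw [CircleDeg1Lift.map_add_int, semiconj_iterate hπ, abs_le]
    have : ((5 : ℕ) + 1 : ℝ) / (2 * q) = 3 / q := by field_simp; norm_num
    rw [this]
    constructor <;> linarith [show 0 < 3 / (q : ℝ) by positivity]) le_rfl
  have e2 := abs_sum_sub_sum_le hπ hπc hq hc happ hK hφ 1 (u := x) (v := F^[q] x + (-p : ℤ)) (by
    rw [CircleDeg1Lift.map_add_int, semiconj_iterate hπ]
    have : ((1 : ℕ) + 1 : ℝ) / (2 * q) = 1 / q := by field_simp; norm_num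
    rw [this]
    have e : π x + q * α + ((-p : ℤ) : ℝ) - π x = q * α - p := by push_cast; ring
    rw [e]
    exact happ.le) ha.le
  rw [hint] at e1 e2
  simp only [← Function.iterate_add_apply] at e1 e2
  have e3 := Finset.sum_range_add (fun i => φ (F^[i] x)) a q
  have e4 := Finset.sum_range_add (fun i => φ (F^[i] x)) q a
  rw [add_comm q a] at e4
  have c1 : ∀ i, F^[a + i] x = F^[i + a] x := fun i => by rw [add_comm]
  have c2 : ∀ i, F^[q + i] x = F^[i + q] x := fun i => by rw [add_comm]
  simp only [c1] at e3
  simp only [c2] at e4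
  rw [abs_le] at *
  push_cast at e1 e2
  constructor <;> linarith [e1.1, e1.2, e2.1, e2.2]

/-- **Denjoy's theorem**: a diffeomorphism with irrational rotation number, the logarithm of whose
derivative is Lipschitz, has no wandering intervals. -/
theorem IsDiffeoLift.strictMono_semiconj (hF : IsDiffeoLift F) (hπ : ∀ x, π (F x) = π x + α)
    (hα : Irrational α) {K : ℝ} (hK : 0 ≤ K)
    (hφ : ∀ x y, |Real.log (deriv F x) - Real.log (deriv F y)| ≤ K * |x - y|) :
    StrictMono π := by
  have hπc := continuous_of_semiconj hπ hα
  refine π.monotone.strictMono_of_injective fun u v => ?_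
  by_contra! hcon
  obtain ⟨huv, hne⟩ := hcon
  wlog hlt : u < v generalizing u v
  · exact this v u huv.symm hne.symm (lt_of_le_of_ne (le_of_not_gt hlt) hne.symm)
  have hvu : v ≤ u + 1 := by
    refine (π.monotone.reflect_lt ?_).le
    rw [CircleDeg1Lift.map_add_one]
    linarith
  -- If π u = π v, the images of [u, v) are pairwise disjoint on the circle, so their lengths tend
  -- to 0. Denjoy–Koksma bounds the derivative of F^q below by exp (-48 K) for arbitrarily large q,
  -- a contradiction.
  have hsum : Summable fun i => F^[i] v - F^[i] u := by
    refine summable_of_sum_range_le (c := 2) (fun i => sub_nonneg.2 (F.monotone.iterate i hlt.le))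
      fun n => sum_iterate_sub_le_two hπ hlt.le hvu fun i hi _ k => ?_
    rw [huv, sub_self]
    exact abs_pos.2 (sub_ne_zero.2 ((hα.natCast_mul hi.ne').ne_int k))
  set c := Real.exp (-(48 * K)) * (v - u)
  have hcpos : 0 < c := mul_pos (Real.exp_pos _) (sub_pos.2 hlt)
  obtain ⟨N, hN⟩ := eventually_atTop.1 (hsum.tendsto_atTop_zero.eventually (gt_mem_nhds hcpos))
  obtain ⟨p, q, hNq, hq, hc, happ⟩ := exists_dirichlet_approx hα N
  refine absurd (hN q hNq) (not_lt.2 ?_)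
  obtain ⟨y, -, hy⟩ := exists_hasDerivAt_eq_slope F^[q] _ zero_lt_one
    (hF.continuous_iterate q).continuousOn fun y _ => hF.hasDerivAt_iterate q y
  have h1 : F^[q] 1 = F^[q] 0 + 1 := by simpa using iterate_add_int F q 0 1
  have h2 : ∑ i ∈ Finset.range q, Real.log (deriv F (F^[i] y)) = 0 := by
    rw [h1] at hy
    simpa using hy
  obtain ⟨z, -, hz⟩ := exists_hasDerivAt_eq_slope F^[q] _ hlt
    (hF.continuous_iterate q).continuousOn fun y _ => hF.hasDerivAt_iterate q y
  have h3 := denjoy_koksma hπ hπc hq hc happ (periodic_log_deriv F) hK hφ z y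
  rw [h2, sub_zero] at h3
  rw [eq_div_iff (sub_pos.2 hlt).ne'] at hz
  rw [← hz]
  exact mul_le_mul_of_nonneg_right (Real.exp_le_exp.2 (neg_le_of_abs_le h3)) (sub_pos.2 hlt).le

end Denjoy

/-! ### Averages over intervals -/

theorem uniformContinuous_of_continuous {F : CircleDeg1Lift} (hF : Continuous F) :
    UniformContinuous F := by
  have h1 : UniformContinuous fun x => F x - x :=
    uniformContinuous_of_periodic (hF.sub continuous_id) fun x => by
      rw [F.map_add_one]
      ring
  simpa using h1.add uniformContinuous_id

/-- X t is the mean of P over [t, t + β]: it is C¹ even if P is merely continuous, and monotonicity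
of P confines it between the end values. -/
theorem exists_average {P : CircleDeg1Lift} (hP : Continuous P) {β : ℝ} (hβ : 0 < β) :
    ∃ X : CircleDeg1Lift, (∀ t, HasDerivAt X (β⁻¹ * (P (t + β) - P t)) t) ∧
      ∀ t, X t ∈ Icc (P t) (P (t + β)) := by
  have hi : ∀ a b, IntervalIntegrable P volume a b := fun a b => hP.intervalIntegrable a b
  have hd : ∀ t, HasDerivAt (fun t => β⁻¹ * ∫ s in t..(t + β), P s) (β⁻¹ * (P (t + β) - P t)) t := by
    intro t
    have h1 : ∀ s, HasDerivAt (fun x => ∫ y in (0 : ℝ)..x, P y) (P s) s := fun s =>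
      intervalIntegral.integral_hasDerivAt_right (hi _ _)
        (hP.stronglyMeasurableAtFilter _ _) hP.continuousAt
    have h2 := ((h1 (t + β)).comp_add_const t β).sub (h1 t)
    refine HasDerivAt.const_mul _ (h2.congr_of_eventuallyEq (Eventually.of_forall fun s => ?_))
    exact (intervalIntegral.integral_interval_sub_left (hi _ _) (hi _ _)).symm
  refine ⟨⟨⟨fun t => β⁻¹ * ∫ s in t..(t + β), P s, ?_⟩, fun t => ?_⟩, hd, fun t => ?_⟩
  · refine monotone_of_hasDerivAt_nonneg hd fun t => mul_nonneg (inv_nonneg.2 hβ.le) ?_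
    exact sub_nonneg.2 (P.monotone (by linarith))
  · change β⁻¹ * ∫ s in (t + 1)..(t + 1 + β), P s = β⁻¹ * (∫ s in t..(t + β), P s) + 1
    have e : t + 1 + β = t + β + 1 := by ring
    rw [e, ← intervalIntegral.integral_comp_add_right]
    simp only [P.map_add_one]
    rw [intervalIntegral.integral_add (hi _ _) intervalIntegrable_const]
    simp only [intervalIntegral.integral_const, smul_eq_mul]
    field_simp
    ring
  · have e : ∀ c : ℝ, ∫ _ in t..(t + β), c = β * c := fun c => by simp
    have h1 : β * P t ≤ ∫ s in t..(t + β), P s := by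
      rw [← e]
      exact intervalIntegral.integral_mono_on (by linarith) intervalIntegrable_const (hi _ _)
        fun s hs => P.monotone hs.1
    have h2 : ∫ s in t..(t + β), P s ≤ β * P (t + β) := by
      rw [← e]
      exact intervalIntegral.integral_mono_on (by linarith) (hi _ _) intervalIntegrable_const
        fun s hs => P.monotone hs.2
    change β⁻¹ * ∫ s in t..(t + β), P s ∈ _
    rw [inv_mul_eq_div, mem_Icc, le_div_iff₀ hβ, div_le_iff₀ hβ]
    constructor <;> linarith

theorem isDiffeoLift_of_average {P X : CircleDeg1Lift} (hP : Continuous P) (hmono : StrictMono P)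
    {β : ℝ} (hβ : 0 < β) (hX : ∀ t, HasDerivAt X (β⁻¹ * (P (t + β) - P t)) t) :
    IsDiffeoLift X :=
  .of_hasDerivAt (by fun_prop)
    (fun t => mul_pos (inv_pos.2 hβ) (sub_pos.2 (hmono (by linarith)))) hX

/-- A diffeomorphism topologically conjugate to the rotation is a limit of `C^1`-conjugates of
the rotation. -/
theorem IsDiffeoLift.exists_conj_rotation_near_of_strictMono {G π : CircleDeg1Lift} {α : ℝ}
    (hG : IsDiffeoLift G) (hπ : ∀ x, π (G x) = π x + α) (hπc : Continuous π) (hm : StrictMono π)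
    {ε : ℝ} (hε : 0 < ε) :
    ∃ X : CircleDeg1Lift, IsDiffeoLift X ∧ (∀ t, |X (t + α) - G (X t)| ≤ ε) ∧
      ∀ t, |deriv X (t + α) / deriv X t - deriv G (X t)| ≤ ε := by
  obtain ⟨u, hu⟩ := CircleDeg1Lift.isUnit_iff_bijective.2
    ⟨hm.injective, π.continuous_iff_surjective.1 hπc⟩
  set P : CircleDeg1Lift := ((u⁻¹ : CircleDeg1Liftˣ) : CircleDeg1Lift) with hP
  have hPe : ⇑P = CircleDeg1Lift.toOrderIso u⁻¹ := by rw [CircleDeg1Lift.coe_toOrderIso]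
  have hPc : Continuous P := hPe ▸ (CircleDeg1Lift.toOrderIso u⁻¹).continuous
  have hPm : StrictMono P := hPe ▸ (CircleDeg1Lift.toOrderIso u⁻¹).strictMono
  have hPG : ∀ t, P (t + α) = G (P t) := fun t => hm.injective <| by
    rw [hπ, ← hu, CircleDeg1Lift.units_apply_inv_apply, CircleDeg1Lift.units_apply_inv_apply]
  obtain ⟨δ₁, hδ₁, h1⟩ := Metric.uniformContinuous_iff.1
    (uniformContinuous_of_continuous hG.continuous) ε hε
  obtain ⟨δ₂, hδ₂, h2⟩ := Metric.uniformContinuous_iff.1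
    (uniformContinuous_of_periodic hG.continuous_deriv G.periodic_deriv) ε hε
  obtain ⟨η, hη, h3⟩ := Metric.uniformContinuous_iff.1
    (uniformContinuous_of_continuous hPc) (min δ₁ δ₂) (by positivity)
  set β := η / 2
  have hβ : 0 < β := by positivity
  have hosc : ∀ t, P (t + β) - P t < min δ₁ δ₂ := fun t => by
    have := @h3 (t + β) t (by
      rw [Real.dist_eq, add_sub_cancel_left, abs_of_pos hβ]
      exact half_lt_self hη)
    exact (le_abs_self _).trans_lt this
  obtain ⟨X, hX, hXI⟩ := exists_average hPc hβ
  have hXd := isDiffeoLift_of_average hPc hPm hβ hX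
  refine ⟨X, hXd, fun t => ?_, fun t => ?_⟩
  · have a1 := hXI (t + α)
    have e : t + α + β = t + β + α := by ring
    rw [e, hPG, hPG] at a1
    have a2 := G.monotone (hXI t).1
    have a3 := G.monotone (hXI t).2
    have a4 : |G (P (t + β)) - G (P t)| < ε := @h1 _ _ (by
      rw [Real.dist_eq, abs_of_nonneg (sub_nonneg.2 (P.monotone (by linarith)))]
      exact (hosc t).trans_le (min_le_left _ _))
    rw [abs_lt] at a4
    rw [abs_le]
    constructor <;> linarith [a1.1, a1.2]
  · have hlt : P t < P (t + β) := hPm (by linarith)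
    obtain ⟨ξ, hξ, hslope⟩ := exists_hasDerivAt_eq_slope G _ hlt
      hG.continuous.continuousOn fun y _ => hG.hasDerivAt y
    have e : t + α + β = t + β + α := by ring
    -- Since P (t + α) = G (P t), this ratio is the slope of G between P t and P (t + β). Both ξ and
    -- X t lie between these points.
    have hq : deriv X (t + α) / deriv X t = deriv G ξ := by
      rw [(hX _).deriv, (hX _).deriv, hslope, e, hPG, hPG]
      exact mul_div_mul_left _ _ (inv_pos.2 hβ).ne'
    rw [hq]
    refine (@h2 _ _ ?_).le
    have := hXI t
    have := (hosc t).trans_le (min_le_right _ _)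
    rw [Real.dist_eq, abs_lt]
    constructor <;> linarith [hξ.1, hξ.2, (hXI t).1, (hXI t).2]

/-- Averaging gains one degree of smoothness, at an arbitrarily small cost in the
`C^1`-topology. -/
theorem IsDiffeoLift.exists_contDiff_succ_near {F : CircleDeg1Lift} (hF : IsDiffeoLift F) {r : ℕ}
    (hr : ContDiff ℝ r F) {ε : ℝ} (hε : 0 < ε) :
    ∃ X : CircleDeg1Lift, IsDiffeoLift X ∧ ContDiff ℝ (r + 1 : ℕ) X ∧
      ∀ t, |X t - F t| ≤ ε ∧ |deriv X t - deriv F t| ≤ ε := by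
  obtain ⟨δ₁, hδ₁, h1⟩ := Metric.uniformContinuous_iff.1
    (uniformContinuous_of_continuous hF.continuous) ε hε
  obtain ⟨δ₂, hδ₂, h2⟩ := Metric.uniformContinuous_iff.1
    (uniformContinuous_of_periodic hF.continuous_deriv F.periodic_deriv) ε hε
  set β := min δ₁ δ₂ / 2 with hβ'
  have hβ : 0 < β := by positivity
  have hβlt : β < min δ₁ δ₂ := half_lt_self (by positivity)
  obtain ⟨X, hX, hXI⟩ := exists_average hF.continuous hβ
  have hXd := isDiffeoLift_of_average hF.continuous hF.strictMono hβ hX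
  refine ⟨X, hXd, ?_, fun t => ⟨?_, ?_⟩⟩
  · push_cast
    refine contDiff_succ_iff_deriv.2 ⟨hXd.differentiable, by simp, ?_⟩
    have : deriv X = fun t => β⁻¹ * (F (t + β) - F t) := funext fun t => (hX t).deriv
    rw [this]
    have hadd : ContDiff ℝ r fun t : ℝ => t + β := contDiff_id.add contDiff_const
    exact contDiff_const.mul ((hr.comp hadd).sub hr)
  · have a4 : |F (t + β) - F t| < ε := @h1 _ _ (by
      rw [Real.dist_eq, add_sub_cancel_left, abs_of_pos hβ]
      exact hβlt.trans_le (min_le_left _ _))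
    rw [abs_lt] at a4
    rw [abs_le]
    constructor <;> linarith [(hXI t).1, (hXI t).2]
  · obtain ⟨ξ, hξ, hslope⟩ := exists_hasDerivAt_eq_slope F _ (show t < t + β by linarith)
      hF.continuous.continuousOn fun y _ => hF.hasDerivAt y
    -- The derivative of the mean is a slope of F, hence a value of F' nearby; this gives
    -- C¹-closeness without a second derivative.
    have hq : deriv X t = deriv F ξ := by
      rw [(hX _).deriv, hslope, add_sub_cancel_left, inv_mul_eq_div]
    rw [hq]
    refine (@h2 _ _ ?_).le
    rw [Real.dist_eq, abs_lt]
    have := hβlt.trans_le (min_le_right _ _)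
    constructor <;> linarith [hξ.1, hξ.2]

theorem IsDiffeoLift.exists_contDiff_near {F : CircleDeg1Lift} (hF : IsDiffeoLift F) (r : ℕ)
    {ε : ℝ} (hε : 0 < ε) :
    ∃ X : CircleDeg1Lift, IsDiffeoLift X ∧ ContDiff ℝ r X ∧
      ∀ t, |X t - F t| ≤ ε ∧ |deriv X t - deriv F t| ≤ ε := by
  induction r generalizing ε with
  | zero => exact ⟨F, hF, by simpa using (contDiff_zero (𝕜 := ℝ)).2 hF.continuous, by simp [hε.le]⟩
  | succ r ih =>
    obtain ⟨Y, hY, hYr, hYF⟩ := ih (half_pos hε)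
    obtain ⟨X, hX, hXr, hXY⟩ := hY.exists_contDiff_succ_near hYr (half_pos hε)
    refine ⟨X, hX, hXr, fun t => ⟨?_, ?_⟩⟩
    · linarith [abs_sub_le (X t) (Y t) (F t), (hXY t).1, (hYF t).1]
    · linarith [abs_sub_le (deriv X t) (deriv Y t) (deriv F t), (hXY t).2, (hYF t).2]

/-! ### Adjusting the rotation number -/

/-- The composition of `F` with the translation by `t`. -/
noncomputable def addConst (F : CircleDeg1Lift) (t : ℝ) : CircleDeg1Lift :=
  (CircleDeg1Lift.translate (Multiplicative.ofAdd t) : CircleDeg1Lift) * F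

theorem addConst_apply (F : CircleDeg1Lift) (t x : ℝ) : addConst F t x = t + F x := by
  rw [addConst, CircleDeg1Lift.mul_apply, CircleDeg1Lift.translate_apply]

theorem coe_addConst (F : CircleDeg1Lift) (t : ℝ) : ⇑(addConst F t) = fun x => t + F x :=
  funext (addConst_apply F t)

theorem deriv_addConst (F : CircleDeg1Lift) (t : ℝ) : deriv (addConst F t) = deriv F := by
  rw [coe_addConst]
  exact deriv_const_add' t

theorem IsDiffeoLift.addConst {F : CircleDeg1Lift} (hF : IsDiffeoLift F) (t : ℝ) :
    IsDiffeoLift (addConst F t) := by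
  refine ⟨?_, fun x => by rw [deriv_addConst]; exact hF.2 x⟩
  rw [coe_addConst]
  exact contDiff_const.add hF.1

theorem translationNumber_addConst_int (F : CircleDeg1Lift) (n : ℤ) :
    (addConst F n).translationNumber = n + F.translationNumber := by
  have h : Commute (CircleDeg1Lift.translate (Multiplicative.ofAdd (n : ℝ)) : CircleDeg1Lift) F := by
    ext x
    simp
  rw [addConst, CircleDeg1Lift.translationNumber_mul_of_commute h,
    CircleDeg1Lift.translationNumber_translate]

/-- It is the uniform limit of the n-th iterates at 0 divided by n, the error being at most 1 / n
whatever t. -/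
theorem continuous_translationNumber_addConst {F : CircleDeg1Lift} (hF : Continuous F) :
    Continuous fun t => (addConst F t).translationNumber := by
  have hit : ∀ n : ℕ, Continuous fun t => (addConst F t)^[n] 0 := fun n => by
    induction n with
    | zero => simpa using continuous_const
    | succ n ih =>
      simp only [Function.iterate_succ_apply', addConst_apply]
      exact continuous_id.add (hF.comp ih)
  refine continuous_of_uniform_approx_of_continuous fun U hU => ?_
  obtain ⟨ε, hε, hU⟩ := Metric.mem_uniformity_dist.1 hU
  obtain ⟨n, hn⟩ := exists_nat_one_div_lt hε
  refine ⟨fun t => (addConst F t)^[n + 1] 0 / (n + 1), (hit _).div_const _, fun t => hU ?_⟩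
  have h1 := (addConst F t).dist_pow_map_zero_mul_translationNumber_le (n + 1)
  rw [CircleDeg1Lift.coe_pow, Real.dist_eq, abs_sub_comm] at h1
  refine lt_of_le_of_lt ?_ hn
  have hpos : (0 : ℝ) < n + 1 := by positivity
  push_cast at h1
  rw [Real.dist_eq, le_div_iff₀ hpos, ← abs_of_pos hpos, ← abs_mul, abs_of_pos hpos, sub_mul,
    div_mul_cancel₀ _ hpos.ne', mul_comm]
  exact h1

theorem exists_addConst_translationNumber_eq {F G : CircleDeg1Lift} (hF : Continuous F) {ε : ℝ}
    (h : ∀ x, |F x - G x| ≤ ε) :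
    ∃ t, |t| ≤ ε ∧ (addConst F t).translationNumber = G.translationNumber := by
  have hε : 0 ≤ ε := (abs_nonneg _).trans (h 0)
  have h1 : (addConst F (-ε)).translationNumber ≤ G.translationNumber :=
    CircleDeg1Lift.translationNumber_mono fun x => by
      rw [addConst_apply]
      linarith [le_of_abs_le (h x)]
  have h2 : G.translationNumber ≤ (addConst F ε).translationNumber :=
    CircleDeg1Lift.translationNumber_mono fun x => by
      rw [addConst_apply]
      linarith [neg_le_of_abs_le (h x)]
  obtain ⟨t, ht, e⟩ := intermediate_value_Icc (by linarith)
    (continuous_translationNumber_addConst hF).continuousOn ⟨h1, h2⟩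
  exact ⟨t, abs_le.2 ht, e⟩

theorem IsDiffeoLift.exists_lipschitz_log_deriv {F : CircleDeg1Lift} (hF : IsDiffeoLift F)
    (h2 : ContDiff ℝ 2 F) : ∃ K, 0 ≤ K ∧
      ∀ x y, |Real.log (deriv F x) - Real.log (deriv F y)| ≤ K * |x - y| := by
  have h1 : ContDiff ℝ 1 (deriv F) := ((contDiff_succ_iff_deriv (n := 1)).1 h2).2.2
  have h3 : ContDiff ℝ 1 fun x => Real.log (deriv F x) := h1.log fun x => (hF.2 x).ne'
  have hp : Function.Periodic (deriv fun x => Real.log (deriv F x)) 1 := fun x => by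
    rw [← deriv_comp_add_const]
    exact congrArg (fun f => deriv f x) (funext (periodic_log_deriv F))
  obtain ⟨K, hK, hb⟩ := exists_bound_of_periodic (h3.continuous_deriv le_rfl) hp
  refine ⟨K, hK.le, fun x y => ?_⟩
  exact convex_univ.norm_image_sub_le_of_norm_deriv_le
    (fun z _ => (h3.differentiable one_ne_zero) z) (fun z _ => hb z) (mem_univ y) (mem_univ x)

/-- Every `C^1`-diffeomorphism with irrational rotation number is a limit of `C^1`-conjugates of
the rotation. -/
theorem IsDiffeoLift.exists_conj_rotation_near {G : CircleDeg1Lift} (hG : IsDiffeoLift G)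
    (hα : Irrational G.translationNumber) {ε : ℝ} (hε : 0 < ε) :
    ∃ X : CircleDeg1Lift, IsDiffeoLift X ∧
      (∀ t, |X (t + G.translationNumber) - G (X t)| ≤ ε) ∧
      ∀ t, |deriv X (t + G.translationNumber) / deriv X t - deriv G (X t)| ≤ ε := by
  obtain ⟨Y, hY, hY2, hYG⟩ := hG.exists_contDiff_near 2 (show 0 < ε / 4 by positivity)
  -- Smoothing may change the rotation number; a translation by |s| ≤ ε / 4 restores it and leaves
  -- the derivative alone.
  obtain ⟨s, hs, hτ⟩ := exists_addConst_translationNumber_eq hY.continuous fun x => (hYG x).1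
  have hZ := hY.addConst s
  obtain ⟨π, hπ⟩ := exists_semiconj_rotation hZ.bijective
  rw [hτ] at hπ
  obtain ⟨K, hK, hlip⟩ := hY.exists_lipschitz_log_deriv hY2
  have hm := hZ.strictMono_semiconj hπ hα hK (by rwa [deriv_addConst])
  obtain ⟨X, hX, hX1, hX2⟩ := hZ.exists_conj_rotation_near_of_strictMono hπ
    (continuous_of_semiconj hπ hα) hm (half_pos hε)
  simp only [addConst_apply] at hX1
  simp only [deriv_addConst] at hX2
  refine ⟨X, hX, fun t => ?_, fun t => ?_⟩
  · have h1 := hX1 t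
    have h2 := (hYG (X t)).1
    rw [abs_le] at *
    constructor <;> linarith [h1.1, h1.2, h2.1, h2.2, hs.1, hs.2]
  · have h1 := hX2 t
    have h2 := (hYG (X t)).2
    rw [abs_le] at *
    constructor <;> linarith [h1.1, h1.2, h2.1, h2.2]

/-! ### Conjugating one diffeomorphism close to another -/

theorem abs_div_sub_div_le {a b a' b' m M δ : ℝ} (hm : 0 < m) (hb : m ≤ b) (hb' : m / 2 ≤ b')
    (ha : |a| ≤ M) (hbM : |b| ≤ M) (haa : |a' - a| ≤ δ) (hbb : |b' - b| ≤ δ) :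
    |a' / b' - a / b| ≤ 4 * M * δ / m ^ 2 := by
  have hb0 : 0 < b := hm.trans_le hb
  have hb0' : 0 < b' := (half_pos hm).trans_le hb'
  have hM : 0 ≤ M := (abs_nonneg _).trans ha
  have hδ : 0 ≤ δ := (abs_nonneg _).trans haa
  have e : a' / b' - a / b = ((a' - a) * b - a * (b' - b)) / (b' * b) := by
    field_simp
    ring
  have h1 : |(a' - a) * b - a * (b' - b)| ≤ 2 * M * δ := by
    have h2 := abs_sub ((a' - a) * b) (a * (b' - b))
    rw [abs_mul, abs_mul] at h2
    have h3 : |a' - a| * |b| ≤ δ * M := by gcongr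
    have h4 : |a| * |b' - b| ≤ M * δ := by gcongr
    linarith
  rw [e, abs_div, abs_of_pos (mul_pos hb0' hb0)]
  calc |(a' - a) * b - a * (b' - b)| / (b' * b) ≤ 2 * M * δ / (m / 2 * m) := by gcongr
    _ = 4 * M * δ / m ^ 2 := by
      field_simp
      ring

namespace IsDiffeoLift

variable {F G : CircleDeg1Lift}

/-- φ brings F near the rotation and X brings the rotation near G. The map X comes first, because
the closeness κ required of φ depends on the bounds and moduli of continuity of X and X'. Closeness
is expressed at the point H y, which avoids H⁻¹. -/
theorem exists_conj_near (hF : IsDiffeoLift F) (hG : IsDiffeoLift G)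
    (hα : Irrational F.translationNumber) (hFG : F.translationNumber = G.translationNumber)
    {ε : ℝ} (hε : 0 < ε) :
    ∃ H : CircleDeg1Lift, IsDiffeoLift H ∧ ∀ y, |H (F y) - G (H y)| ≤ ε ∧
      |deriv H (F y) * deriv F y / deriv H y - deriv G (H y)| ≤ ε := by
  obtain ⟨X, hX, hX1, hX2⟩ := hG.exists_conj_rotation_near (hFG ▸ hα) (show 0 < ε / 4 by positivity)
  rw [← hFG] at hX1 hX2
  set α := F.translationNumber
  obtain ⟨m, hm, hmX⟩ := exists_lower_bound_of_periodic hX.continuous_deriv X.periodic_deriv hX.2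
  obtain ⟨M, hM, hMX⟩ := exists_bound_of_periodic hX.continuous_deriv X.periodic_deriv
  -- An error σ in the numerator changes the quotient of derivatives by at most 4 M σ / m² = ε / 4.
  set σ := m ^ 2 * ε / (16 * M) with hσ'
  have hσ : 0 < σ := by positivity
  have hσε : 4 * M * σ / m ^ 2 = ε / 4 := by
    rw [hσ']
    field_simp
    norm_num
  obtain ⟨δ₁, hδ₁, h1⟩ := Metric.uniformContinuous_iff.1
    (uniformContinuous_of_periodic hX.continuous_deriv X.periodic_deriv) σ hσ
  obtain ⟨δ₂, hδ₂, h2⟩ := Metric.uniformContinuous_iff.1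
    (uniformContinuous_of_continuous hX.continuous) (ε / 4) (by positivity)
  set κ := min (min (δ₁ / 2) (δ₂ / 2)) (ε * m / (8 * M)) with hκ'
  have hκ : 0 < κ := by positivity
  have hκ1 : κ < δ₁ := ((min_le_left _ _).trans (min_le_left _ _)).trans_lt (half_lt_self hδ₁)
  have hκ2 : κ < δ₂ := ((min_le_left _ _).trans (min_le_right _ _)).trans_lt (half_lt_self hδ₂)
  obtain ⟨φ, hφ, hφ1, hφ2⟩ := hF.exists_conj_near_rotation hα hκ
  refine ⟨X * φ, hX.mul hφ, fun y => ⟨?_, ?_⟩⟩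
  · simp only [CircleDeg1Lift.mul_apply]
    have a1 : |X (φ (F y)) - X (φ y + α)| < ε / 4 := @h2 _ _ ((hφ2 y).trans_lt hκ2)
    have := abs_sub_le (X (φ (F y))) (X (φ y + α)) (G (X (φ y)))
    linarith [hX1 (φ y)]
  · rw [hX.deriv_mul hφ, hX.deriv_mul hφ, CircleDeg1Lift.mul_apply]
    set s := φ (F y)
    set t := φ y
    set ρ := deriv φ (F y) * deriv F y / deriv φ y with hρ
    have e : deriv X s * deriv φ (F y) * deriv F y / (deriv X t * deriv φ y) =
        deriv X s / deriv X t * ρ := by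
      rw [hρ]
      ring
    rw [e]
    have a1 : |deriv X s - deriv X (t + α)| ≤ σ := (@h1 _ _ ((hφ2 y).trans_lt hκ1)).le
    have a2 := abs_div_sub_div_le hm (hmX t) ((half_le_self hm.le).trans (hmX t)) (hMX (t + α))
      (hMX t) a1 (by simpa using hσ.le)
    rw [hσε] at a2
    have a3 : |deriv X s / deriv X t * ρ - deriv X s / deriv X t| ≤ ε / 8 := by
      have h4 : deriv X s / deriv X t * ρ - deriv X s / deriv X t =
        deriv X s / deriv X t * (ρ - 1) := by ring
      rw [h4, abs_mul, abs_div, abs_of_pos (hX.2 t)]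
      calc |deriv X s| / deriv X t * |ρ - 1| ≤ M / m * (ε * m / (8 * M)) := by
            gcongr
            · exact hMX s
            · exact hmX t
            · exact (hφ1 y).trans (min_le_right _ _)
        _ = ε / 8 := by field_simp
    have a4 := hX2 t
    rw [abs_le] at *
    constructor <;> linarith [a2.1, a2.2, a3.1, a3.2, a4.1, a4.2]

/-- If `F` and `G` have the same irrational rotation number, then `F` has smooth conjugates
`H F H⁻¹` arbitrarily close to `G` in the `C^1`-topology. -/
theorem exists_contDiff_conj_near (hF : IsDiffeoLift F) (hG : IsDiffeoLift G)
    (hα : Irrational F.translationNumber) (hFG : F.translationNumber = G.translationNumber)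
    (r : ℕ) {ε : ℝ} (hε : 0 < ε) :
    ∃ H : CircleDeg1Lift, IsDiffeoLift H ∧ ContDiff ℝ r H ∧ ∀ y, |H (F y) - G (H y)| < ε ∧
      |deriv H (F y) * deriv F y / deriv H y - deriv G (H y)| < ε := by
  obtain ⟨Y, hY, hY'⟩ := hF.exists_conj_near hG hα hFG (show 0 < ε / 4 by positivity)
  obtain ⟨m, hm, hmY⟩ := exists_lower_bound_of_periodic hY.continuous_deriv Y.periodic_deriv hY.2
  obtain ⟨M, hM, hMY⟩ := exists_bound_of_periodic hY.continuous_deriv Y.periodic_deriv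
  obtain ⟨L, hL, hLF⟩ := exists_bound_of_periodic hF.continuous_deriv F.periodic_deriv
  obtain ⟨δ₁, hδ₁, h1⟩ := Metric.uniformContinuous_iff.1
    (uniformContinuous_of_periodic hG.continuous_deriv G.periodic_deriv) (ε / 4) (by positivity)
  obtain ⟨δ₂, hδ₂, h2⟩ := Metric.uniformContinuous_iff.1
    (uniformContinuous_of_continuous hG.continuous) (ε / 4) (by positivity)
  -- The bounds δ₁ and δ₂ control G' and G at H y against Y y, m / 2 keeps H' at least m / 2, and
  -- the last term makes the error of the quotient, multiplied by F' ≤ L, at most ε / 4.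
  set κ := min (min (min (δ₁ / 2) (δ₂ / 2)) (min (ε / 4) (m / 2))) (m ^ 2 * ε / (16 * M * L))
    with hκ'
  have hκ : 0 < κ := by positivity
  have hκ0 : κ ≤ min (min (δ₁ / 2) (δ₂ / 2)) (min (ε / 4) (m / 2)) := min_le_left _ _
  have hκ1 : κ < δ₁ := (hκ0.trans ((min_le_left _ _).trans (min_le_left _ _))).trans_lt
    (half_lt_self hδ₁)
  have hκ2 : κ < δ₂ := (hκ0.trans ((min_le_left _ _).trans (min_le_right _ _))).trans_lt
    (half_lt_self hδ₂)
  have hκ3 : κ ≤ ε / 4 := hκ0.trans ((min_le_right _ _).trans (min_le_left _ _))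
  have hκ4 : κ ≤ m / 2 := hκ0.trans ((min_le_right _ _).trans (min_le_right _ _))
  have hκ5 : 4 * M * κ / m ^ 2 * L ≤ ε / 4 := by
    calc 4 * M * κ / m ^ 2 * L ≤ 4 * M * (m ^ 2 * ε / (16 * M * L)) / m ^ 2 * L := by
          gcongr
          exact min_le_right _ _
      _ = ε / 4 := by
          field_simp
          norm_num
  obtain ⟨H, hH, hHr, hHY⟩ := hY.exists_contDiff_near r hκ
  refine ⟨H, hH, hHr, fun y => ⟨?_, ?_⟩⟩
  · have a1 : |G (H y) - G (Y y)| < ε / 4 := @h2 _ _ ((hHY y).1.trans_lt hκ2)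
    have a2 := (hHY (F y)).1.trans hκ3
    have a3 := (hY' y).1
    rw [abs_lt] at *
    rw [abs_le] at *
    constructor <;> linarith [a1.1, a1.2, a2.1, a2.2, a3.1, a3.2]
  · have a1 : |deriv G (H y) - deriv G (Y y)| < ε / 4 := @h1 _ _ ((hHY y).1.trans_lt hκ1)
    have a2 := abs_div_sub_div_le hm (hmY y)
      (by linarith [neg_le_of_abs_le ((hHY y).2.trans hκ4), hmY y])
      (hMY (F y)) (hMY y) (hHY (F y)).2 (hHY y).2
    have a3 : |deriv H (F y) * deriv F y / deriv H y - deriv Y (F y) * deriv F y / deriv Y y| ≤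
        ε / 4 := by
      have e : deriv H (F y) * deriv F y / deriv H y - deriv Y (F y) * deriv F y / deriv Y y =
        (deriv H (F y) / deriv H y - deriv Y (F y) / deriv Y y) * deriv F y := by ring
      rw [e, abs_mul]
      refine le_trans ?_ hκ5
      gcongr
      exact hLF y
    have a4 := (hY' y).2
    rw [abs_lt] at *
    rw [abs_le] at *
    constructor <;> linarith [a1.1, a1.2, a3.1, a3.2, a4.1, a4.2]

end IsDiffeoLift

/-! ### Lifts and circle homeomorphisms -/

theorem IsLift.mul {F G : CircleDeg1Lift} {f g : UnitAddCircle ≃ₜ UnitAddCircle}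
    (hF : IsLift F f) (hG : IsLift G g) : IsLift (F * G) (f * g) := fun x => by
  rw [CircleDeg1Lift.mul_apply, hF, hG]
  rfl

theorem IsLift.addConst_int {F : CircleDeg1Lift} {f : UnitAddCircle ≃ₜ UnitAddCircle}
    (hF : IsLift F f) (n : ℤ) : IsLift (addConst F n) f := fun x => by
  rw [addConst_apply, AddCircle.coe_add, hF x, add_eq_right]
  exact (AddCircle.coe_eq_zero_iff (1 : ℝ)).2 ⟨n, by simp⟩

/-- The circle map covered by a lift. -/
noncomputable def circleMap (F : CircleDeg1Lift) : UnitAddCircle → UnitAddCircle :=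
  Function.Periodic.lift (f := fun x : ℝ => ((F x : ℝ) : UnitAddCircle)) (c := (1 : ℝ)) fun x => by
    simp only [F.map_add_one, AddCircle.coe_add, AddCircle.coe_period, add_zero]

theorem circleMap_coe (F : CircleDeg1Lift) (x : ℝ) :
    circleMap F (x : UnitAddCircle) = ((F x : ℝ) : UnitAddCircle) :=
  Function.Periodic.lift_coe _ x

theorem continuous_circleMap {F : CircleDeg1Lift} (hF : Continuous F) :
    Continuous (circleMap F) := by
  refine (QuotientAddGroup.isQuotientMap_mk (AddSubgroup.zmultiples (1 : ℝ))).continuous_iff.2 ?_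
  have : circleMap F ∘ QuotientAddGroup.mk = fun x : ℝ => ((F x : ℝ) : UnitAddCircle) :=
    funext (circleMap_coe F)
  rw [this]
  exact (AddCircle.continuous_mk' (1 : ℝ)).comp hF

theorem continuous_units (u : CircleDeg1Liftˣ) : Continuous (u : CircleDeg1Lift) := by
  have := (CircleDeg1Lift.toOrderIso u).continuous
  rwa [CircleDeg1Lift.coe_toOrderIso] at this

/-- The circle homeomorphism covered by an invertible lift. -/
noncomputable def circleHomeo (u : CircleDeg1Liftˣ) : UnitAddCircle ≃ₜ UnitAddCircle where
  toFun := circleMap u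
  invFun := circleMap (u⁻¹ : CircleDeg1Liftˣ)
  left_inv z := by
    induction z using QuotientAddGroup.induction_on with
    | H x => rw [circleMap_coe, circleMap_coe, CircleDeg1Lift.units_inv_apply_apply]
  right_inv z := by
    induction z using QuotientAddGroup.induction_on with
    | H x => rw [circleMap_coe, circleMap_coe, CircleDeg1Lift.units_apply_inv_apply]
  continuous_toFun := continuous_circleMap (continuous_units u)
  continuous_invFun := continuous_circleMap (continuous_units u⁻¹)

theorem isLift_circleHomeo (u : CircleDeg1Liftˣ) : IsLift u (circleHomeo u) := fun x =>
  (circleMap_coe u x).symm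

theorem isLift_circleHomeo_inv (u : CircleDeg1Liftˣ) :
    IsLift (u⁻¹ : CircleDeg1Liftˣ) (circleHomeo u)⁻¹ := fun x =>
  (circleMap_coe (u⁻¹ : CircleDeg1Liftˣ) x).symm

theorem circleHomeo_mem_Diff {u : CircleDeg1Liftˣ} (hu : IsDiffeoLift u) {r : ℕ}
    (hr : ContDiff ℝ r (u : CircleDeg1Lift)) : circleHomeo u ∈ Diff r := by
  refine ⟨⟨u, isLift_circleHomeo u, hr⟩, ⟨_, isLift_circleHomeo_inv u, ?_⟩⟩
  set e := (CircleDeg1Lift.toOrderIso u).toHomeomorph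
  have he : ⇑e = (u : CircleDeg1Lift) := CircleDeg1Lift.coe_toOrderIso u
  have hes : ⇑e.symm = (u⁻¹ : CircleDeg1Liftˣ) := CircleDeg1Lift.coe_toOrderIso_symm u
  rw [← hes]
  exact e.contDiff_symm_deriv (fun x => (hu.2 x).ne') (fun x => by rw [he]; exact hu.hasDerivAt x)
    (by rwa [he])

theorem Diff_anti {r s : ℕ} (h : r ≤ s) : Diff s ≤ Diff r := by
  have hle : (r : WithTop ℕ∞) ≤ s := by exact_mod_cast h
  have key : ∀ f, HasCrLift s f → HasCrLift r f := fun f ⟨F, hF, hFs⟩ => ⟨F, hF, hFs.of_le hle⟩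
  exact fun f hf => ⟨key _ hf.1, key _ hf.2⟩

/-- A C¹ lift E of the inverse satisfies E∘F = id + n, and the chain rule forbids a zero of F'. -/
theorem Diff1.isDiffeoLift_lift (f : Diff1) : IsDiffeoLift f.lift := by
  obtain ⟨E, hE, hE1⟩ := f.2.2
  have hE1 : ContDiff ℝ 1 E := by exact_mod_cast hE1
  have hF := f.contDiff_lift
  have h1 : IsLift (E * f.lift) 1 := by
    have := IsLift.mul hE f.isLift_lift
    rwa [show (f.1 : UnitAddCircle ≃ₜ UnitAddCircle)⁻¹ * f.toHomeo = 1 from inv_mul_cancel _]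
      at this
  obtain ⟨n, hn⟩ := h1.exists_eq_add_int (G := 1) (fun x => rfl)
    (by rw [CircleDeg1Lift.coe_mul]; exact hE1.continuous.comp hF.continuous)
    (by rw [CircleDeg1Lift.coe_one]; exact continuous_id)
  refine ⟨hF, fun x => lt_of_le_of_ne f.lift.monotone.deriv_nonneg fun h0 => ?_⟩
  have h2 : HasDerivAt (fun y => E (f.lift y)) (deriv E (f.lift x) * deriv f.lift x) x :=
    ((hE1.differentiable one_ne_zero _).hasDerivAt).comp x
      (hF.differentiable one_ne_zero x).hasDerivAt
  have h3 : (fun y => E (f.lift y)) = fun y => y + (n : ℝ) := funext fun y => by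
    simpa using hn y
  rw [h3, ← h0, mul_zero] at h2
  exact zero_ne_one (h2.unique ((hasDerivAt_id x).add_const _))

/-! ### Conjugacy classes: invariance of the rotation number and density -/

theorem translationNumber_eq_of_isLift {F G : CircleDeg1Lift}
    {f : UnitAddCircle ≃ₜ UnitAddCircle} (hF : IsLift F f) (hG : IsLift G f)
    (hFc : Continuous F) (hGc : Continuous G) :
    (F.translationNumber : UnitAddCircle) = G.translationNumber := by
  obtain ⟨n, hn⟩ := hF.exists_eq_add_int hG hFc hGc
  have : F = addConst G n := CircleDeg1Lift.ext fun x => by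
    rw [hn, addConst_apply, add_comm]
  rw [this, translationNumber_addConst_int, AddCircle.coe_add, add_eq_right]
  exact (AddCircle.coe_eq_zero_iff (1 : ℝ)).2 ⟨n, by simp⟩

/-- Two lifts related as the two sides of `(h f h⁻¹) h = h f`. -/
theorem exists_conj_lift_eq {f k : Diff1} {h : UnitAddCircle ≃ₜ UnitAddCircle}
    (hk : k.toHomeo = h * f.toHomeo * h⁻¹) {H F : CircleDeg1Lift} (hH : IsLift H h)
    (hHc : Continuous H) (hF : IsLift F f.toHomeo) (hFc : Continuous F) :
    ∃ n : ℤ, ∀ x, k.lift (H x) = H (F x) + n := by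
  have h1 : IsLift (k.lift * H) (h * f.toHomeo) := by
    have := k.isLift_lift.mul hH
    rwa [hk, inv_mul_cancel_right] at this
  refine h1.exists_eq_add_int (hH.mul hF) ?_ ?_
  · rw [CircleDeg1Lift.coe_mul]
    exact k.contDiff_lift.continuous.comp hHc
  · rw [CircleDeg1Lift.coe_mul]
    exact hHc.comp hFc

theorem conjClass_subset_rotationClass {f : Diff1} {a : UnitAddCircle} (hf : f ∈ rotationClass a)
    (r : ℕ) : conjClass r f ⊆ rotationClass a := by
  rintro k ⟨h, ⟨⟨H, hH, hHr⟩, -⟩, hk⟩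
  obtain ⟨n, hn⟩ := exists_conj_lift_eq hk hH hHr.continuous f.isLift_lift
    f.contDiff_lift.continuous
  -- The integer n is moved inside H, which commutes with integer translations. Only continuity of H
  -- matters, so r = 0 is covered.
  have hsemi : Function.Semiconj H (addConst f.lift n) k.lift := fun x => by
    rw [hn, addConst_apply, CircleDeg1Lift.map_int_add, add_comm]
  have h1 := CircleDeg1Lift.translationNumber_eq_of_semiconj hsemi
  rw [← hf]
  change (k.lift.translationNumber : UnitAddCircle) = f.lift.translationNumber
  rw [← h1]
  refine translationNumber_eq_of_isLift (f.isLift_lift.addConst_int n) f.isLift_lift ?_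
    f.contDiff_lift.continuous
  exact (f.isDiffeoLift_lift.addConst n).continuous

theorem dist_coe_le (x y : ℝ) : dist (x : UnitAddCircle) (y : UnitAddCircle) ≤ |x - y| := by
  rw [dist_eq_norm, ← AddCircle.coe_sub, UnitAddCircle.norm_eq]
  simpa using round_le (x - y) 0

theorem exists_mem_conjClass_near {a : ℝ} (ha : Irrational a) {f g : Diff1}
    (hf : f ∈ rotationClass (a : UnitAddCircle)) (hg : g ∈ rotationClass (a : UnitAddCircle))
    (r : ℕ) {ε : ℝ} (hε : 0 < ε) :
    ∃ k ∈ conjClass r f, (∀ z, dist (g.toHomeo z) (k.toHomeo z) < ε) ∧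
      ∀ x, dist (g.derivative x) (k.derivative x) < ε := by
  have hint : ∀ e : Diff1, e ∈ rotationClass (a : UnitAddCircle) →
      ∃ n : ℤ, e.lift.translationNumber = a + n := fun e he => by
    have h1 : ((e.lift.translationNumber - a : ℝ) : UnitAddCircle) = 0 := by
      rw [AddCircle.coe_sub, sub_eq_zero]
      exact he
    obtain ⟨n, hn⟩ := (AddCircle.coe_eq_zero_iff (1 : ℝ)).1 h1
    refine ⟨n, ?_⟩
    rw [zsmul_one] at hn
    linarith
  obtain ⟨n, hn⟩ := hint f hf
  obtain ⟨m, hm⟩ := hint g hg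
  -- The chosen lifts have translation numbers equal only modulo 1; the shift by m - n makes them
  -- equal.
  set F := addConst f.lift ((m - n : ℤ) : ℝ) with hFdef
  have hF : IsDiffeoLift F := f.isDiffeoLift_lift.addConst _
  have hFl : IsLift F f.toHomeo := f.isLift_lift.addConst_int _
  have hτ : F.translationNumber = g.lift.translationNumber := by
    rw [hFdef, translationNumber_addConst_int, hn, hm]
    push_cast
    ring
  -- Class r + 1 rather than r ensures that h is a C¹-diffeomorphism even for r = 0, so that the
  -- conjugate lies in `Diff1`.
  obtain ⟨H, hH, hHr, hHε⟩ := hF.exists_contDiff_conj_near g.isDiffeoLift_lift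
    (by rw [hτ, hm]; exact ha.add_intCast m) hτ (r + 1) hε
  obtain ⟨u, rfl⟩ := CircleDeg1Lift.isUnit_iff_bijective.2 hH.bijective
  have hu : circleHomeo u ∈ Diff (r + 1) := circleHomeo_mem_Diff hH hHr
  set h := circleHomeo u
  have hu1 : h ∈ Diff 1 := Diff_anti (Nat.le_add_left 1 r) hu
  set k : Diff1 := ⟨h * f.toHomeo * h⁻¹, (Diff 1).mul_mem ((Diff 1).mul_mem hu1 f.2)
    ((Diff 1).inv_mem hu1)⟩
  have hk : k.toHomeo = h * f.toHomeo * h⁻¹ := rfl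
  obtain ⟨j, hj⟩ := exists_conj_lift_eq hk (isLift_circleHomeo u) hH.continuous hFl hF.continuous
  refine ⟨k, ⟨h, Diff_anti (Nat.le_succ r) hu, hk⟩, fun z => ?_, fun x => ?_⟩
  · obtain ⟨w, rfl⟩ := h.surjective z
    induction w using QuotientAddGroup.induction_on with
    | H y =>
      have e1 : h (y : UnitAddCircle) = (((u : CircleDeg1Lift) y : ℝ) : UnitAddCircle) :=
        (isLift_circleHomeo u y).symm
      have e2 : k.toHomeo (h (y : UnitAddCircle)) =
          (((u : CircleDeg1Lift) (F y) : ℝ) : UnitAddCircle) := by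
        rw [isLift_circleHomeo u (F y), hFl y]
        change h (f.toHomeo (h⁻¹ (h (y : UnitAddCircle)))) = _
        congr 2
        exact h.symm_apply_apply _
      have e3 : g.toHomeo (h (y : UnitAddCircle)) =
          ((g.lift ((u : CircleDeg1Lift) y) : ℝ) : UnitAddCircle) := by
        rw [e1, g.isLift_lift]
      change dist (g.toHomeo (h (y : UnitAddCircle))) (k.toHomeo (h (y : UnitAddCircle))) < ε
      rw [e2, e3, dist_comm]
      exact (dist_coe_le _ _).trans_lt (hHε y).1
  -- Differentiating k.lift∘H = H∘F + j at y gives the derivative of the conjugate at H y.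
  · obtain ⟨y, rfl⟩ := hH.bijective.surjective x
    have d1 := (k.isDiffeoLift_lift.hasDerivAt ((u : CircleDeg1Lift) y)).comp y (hH.hasDerivAt y)
    have d2 := ((hH.hasDerivAt (F y)).comp y (hF.hasDerivAt y)).add_const (j : ℝ)
    have e : k.lift ∘ (u : CircleDeg1Lift) =
        fun x => ((u : CircleDeg1Lift) ∘ F) x + (j : ℝ) := funext hj
    rw [e] at d1
    have e2 : k.derivative ((u : CircleDeg1Lift) y) = deriv (u : CircleDeg1Lift) (F y) *
        deriv F y / deriv (u : CircleDeg1Lift) y := by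
      rw [eq_div_iff (hH.2 y).ne']
      exact d1.unique d2
    rw [dist_comm, e2]
    exact (hHε y).2

theorem rotationClass_subset_closure_conjClass {a : ℝ} (ha : Irrational a) {f : Diff1}
    (hf : f ∈ rotationClass (a : UnitAddCircle)) (r : ℕ) :
    rotationClass (a : UnitAddCircle) ⊆ closure (conjClass r f) := by
  intro g hg
  choose k hk hk1 hk2 using fun n : ℕ =>
    exists_mem_conjClass_near ha hf hg r (Nat.one_div_pos_of_nat (α := ℝ) (n := n))
  refine mem_closure_of_tendsto (b := atTop) (f := k) ?_ (Eventually.of_forall hk)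
  have hsmall : ∀ ε > 0, ∀ᶠ n : ℕ in atTop, (1 : ℝ) / (n + 1) < ε := fun ε hε =>
    tendsto_one_div_add_atTop_nhds_zero_nat.eventually (gt_mem_nhds hε)
  rw [nhds_induced, tendsto_comap_iff]
  refine Tendsto.prodMk_nhds ?_ ?_
  · rw [UniformFun.tendsto_iff_tendstoUniformly, Metric.tendstoUniformly_iff]
    intro ε hε
    filter_upwards [hsmall ε hε] with n hn z
    exact (hk1 n z).trans hn
  · rw [UniformFun.tendsto_iff_tendstoUniformly, Metric.tendstoUniformly_iff]
    intro ε hε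
    filter_upwards [hsmall ε hε] with n hn x
    exact (hk2 n x).trans hn

end CircleDiffeo

theorem theorem1 (a : ℝ) (ha : Irrational a) (f : CircleDiffeo.Diff1)
    (hf : f ∈ CircleDiffeo.rotationClass (a : UnitAddCircle)) :
    (CircleDiffeo.conjClass 1 f ⊆ CircleDiffeo.rotationClass (a : UnitAddCircle) ∧
      CircleDiffeo.rotationClass (a : UnitAddCircle) ⊆ closure (CircleDiffeo.conjClass 1 f)) ∧
    ∀ r : ℕ,
      CircleDiffeo.conjClass r f ⊆ CircleDiffeo.rotationClass (a : UnitAddCircle) ∧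
      CircleDiffeo.rotationClass (a : UnitAddCircle) ⊆ closure (CircleDiffeo.conjClass r f) := by
  have key := fun r : ℕ => And.intro (CircleDiffeo.conjClass_subset_rotationClass hf r)
    (CircleDiffeo.rotationClass_subset_closure_conjClass ha hf r)
  exact ⟨key 1, key⟩
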